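/- Let $d\ge 1$ be an integer, write $B_r=\{x\in\mathbb R^d:|x|\le r\}$ and let $|B_r|$ be its volume. Let $0<\epsilon<d/2$, $0<\eta\le 1/2$, and let $\rho_\eta\ge 0$ be a smooth function on $\mathbb R$ supported in $[1-\eta,1+\eta]$ with $\int\rho_\eta(t)\,dt=1$. Set $$Q_{0,\eta}(x):=\int_{1-\eta}^{1+\eta}\frac{(1_{B_t}*1_{B_t})(x)}{|B_t|}\,\rho_\eta(t)\,dt ,\qquad x\in\mathbb R^d .$$ Call a real function $K$, defined almost everywhere on $\mathbb R^d$, positive definite if it is locally integrable and $\iint K(x-y)\varphi(x)\overline{\varphi(y)}\,dx\,dy\ge 0$ for all $\varphi\in C_c^\infty(\mathbb R^d;\mathbb C)$. Then there is a constant $C=C(\rho_\eta,d,\epsilon)>0$, depending only on $\rho_\eta$, $d$ and $\epsilon$, such that the following holds for every $s$ with $\epsilon\le s\le d-\epsilon$, every integer $M\ge 1$, and all real numbers $0<R_1<\dots<R_M$ with $R_{k+1}>(1+4\sqrt d\,|B_1|)R_k$ for $1\le k<M$. With $Q_{i,\eta}(x):=Q_{0,\eta}(x/R_i)$, the kernels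 $$\frac{C}{M}|x|^{-s}\pm\frac1M\sum_{i=1}^M\left(\frac{1-Q_{i,\eta}(x)}{|x|^s}-\left(\int_{\mathbb R^d}Q_{i,\eta}(y)\,dy\right)^{-1}\int_{\mathbb R^d}\frac{Q_{i,\eta}(y)}{|x-y|^s}\,dy\right)$$ (for both choices of the sign) and $$\frac1M\sum_{i=1}^M\left[\left(\int_{\mathbb R^d}Q_{i,\eta}(y)\,dy\right)^{-1}\int_{\mathbb R^d}\frac{Q_{i,\eta}(y)}{|x-y|^s}\,dy\right],$$ as well as $$\frac{C}{|x|^s}\pm\frac{Q_{i,\eta}(x)}{|x|^s}\qquad\text{for every }1\le i\le M\text{ and both choices of the sign},$$ are positive definite. -/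

import Mathlib

open MeasureTheory Set
open scoped ContDiff ComplexConjugate ComplexOrder Convolution

noncomputable section

namespace FeffermanGregg

/-- `ℝ^d` with its Euclidean norm. -/
abbrev E (d : ℕ) : Type := EuclideanSpace ℝ (Fin d)

/-- The closed ball `B_r` of radius `r` centred at the origin of `ℝ^d`. -/
def B (d : ℕ) (r : ℝ) : Set (E d) := Metric.closedBall 0 r

/-- The volume `|B_r|`. -/
def volB (d : ℕ) (r : ℝ) : ℝ := volume.real (B d r)

/-- The indicator function `1_{B_r}`. -/
def indB (d : ℕ) (r : ℝ) : E d → ℝ := (B d r).indicator 1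

/-- The self-convolution `1_{B_r} * 1_{B_r}`. -/
def ballConv (d : ℕ) (r : ℝ) : E d → ℝ :=
  indB d r ⋆[ContinuousLinearMap.mul ℝ ℝ, volume] indB d r

/-- An admissible averaging profile: a nonnegative function in `C_0^∞([1-η,1+η])` of integral one. -/
structure IsProfile (η : ℝ) (ρ : ℝ → ℝ) : Prop where
  smooth : ContDiff ℝ ∞ ρ
  support_subset : tsupport ρ ⊆ Icc (1 - η) (1 + η)
  nonneg : ∀ t, 0 ≤ ρ t
  integral_eq_one : ∫ t, ρ t = 1

/-- The mollified ball self-convolution at unit scale,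
`Q_{0,η}(x) = ∫_{1-η}^{1+η} (1_{B_t} * 1_{B_t})(x) / |B_t| ρ(t) dt`. -/
def Q₀ (d : ℕ) (η : ℝ) (ρ : ℝ → ℝ) (x : E d) : ℝ :=
  ∫ t in (1 - η)..(1 + η), ballConv d t x / volB d t * ρ t

/-- The mollified ball self-convolution at scale `R`, `Q_R(x) = Q_{0,η}(x / R)`. -/
def Q (d : ℕ) (η : ℝ) (ρ : ℝ → ℝ) (R : ℝ) (x : E d) : ℝ := Q₀ d η ρ (R⁻¹ • x)

/-- The average `(∫ Q_R)⁻¹ ∫ Q_R(y) |x - y|^{-s} dy`. -/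
def avgRiesz (d : ℕ) (η : ℝ) (ρ : ℝ → ℝ) (s R : ℝ) (x : E d) : ℝ :=
  (∫ y, Q d η ρ R y)⁻¹ * ∫ y, Q d η ρ R y / ‖x - y‖ ^ s

/-- The error term `(1 - Q_R(x)) / |x|^s - (∫ Q_R)⁻¹ ∫ Q_R(y) |x - y|^{-s} dy`. -/
def errRiesz (d : ℕ) (η : ℝ) (ρ : ℝ → ℝ) (s R : ℝ) (x : E d) : ℝ :=
  (1 - Q d η ρ R x) / ‖x‖ ^ s - avgRiesz d η ρ s R x

/-- Scales `0 < R_1 < ⋯ < R_M` with `R_{k+1} > (1 + 4 √d |B_1|) R_k`. -/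
structure IsScales (d M : ℕ) (R : ℕ → ℝ) : Prop where
  pos : 0 < R 1
  growth : ∀ k, 1 ≤ k → k < M → (1 + 4 * √(d : ℝ) * volB d 1) * R k < R (k + 1)

/-- Positive definiteness of a translation-invariant kernel `K(x - y)` on `ℝ^d`, where `K` may be
singular (or undefined) at the origin: `K` is locally integrable and
`∬ K(x - y) φ(x) conj(φ(y)) dx dy` is real and nonnegative for all `φ ∈ C_c^∞(ℝ^d; ℂ)`. -/
def IsPositiveDefinite {d : ℕ} (K : E d → ℝ) : Prop :=
  LocallyIntegrable K volume ∧
    ∀ φ : E d → ℂ, ContDiff ℝ ∞ φ → HasCompactSupport φ →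
      0 ≤ ∫ x, ∫ y, (K (x - y) : ℂ) * φ x * conj (φ y)

end FeffermanGregg

end

/-!
On the Fourier side every kernel here is a multiplier times the transform of `‖x‖ ^ (-s)`, which
is a positive multiple of `‖k‖ ^ (-a)` with `a = d - s`; positive definiteness says that the
multiplier is nonnegative. If the cutoff `Q` has transform `m ≥ 0`, the average of the Riesz
kernel has multiplier `m k / ∫ Q`, its product with `Q` has `‖k‖ ^ a * ∫ ‖l - k‖ ^ (-a) * m l`,
and the error has multiplier `p k`, one minus both of these. The product multiplier is bounded,
and `|p k| ≤ C * min (‖k‖ ^ e) (‖k‖ ^ e)⁻¹` uniformly in `s`. Rescaling by `R` turns `p k` into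
`p (R • k)`, so over lacunary scales these bounds sum to a constant independent of `M`.

The large frequencies require `m k = O(‖k‖ ^ (-(d + 1)))`, which is where averaging over the
radius enters. The overlap of two balls is Lipschitz with nonnegative transform; testing the
transform against two Gaussians of width comparable to `r` shows that it has mass `O(1 / r)` on
the annulus `‖k‖ ∼ r`, and averaging over dilations turns the bound on the mass into a pointwise
one.
-/

noncomputable section

namespace FeffermanGregg

open scoped FourierTransform
open Filter
open Module (finrank)
open Real (Gamma)

/-! ### The Fourier transform of the Riesz kernel -/

lemma norm_rpow_neg_mul_le_indicator_add {V : Type*} [NormedAddCommGroup V] {s : ℝ} (hs : 0 ≤ s)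
    {c b : ℝ} (hc : 0 ≤ c) (hcb : c ≤ b) (z : V) :
    ‖z‖ ^ (-s) * c ≤ b * (Metric.ball (0 : V) 1).indicator (fun z => ‖z‖ ^ (-s)) z + c := by
  by_cases hz : z ∈ Metric.ball (0 : V) 1
  · rw [indicator_of_mem hz]
    nlinarith [Real.rpow_nonneg (norm_nonneg z) (-s)]
  · rw [indicator_of_notMem hz]
    have := Real.rpow_le_one_of_one_le_of_nonpos (not_lt.1 (mt mem_ball_zero_iff.2 hz))
      (neg_nonpos.2 hs)
    nlinarith

section

variable {V : Type*} [NormedAddCommGroup V] [InnerProductSpace ℝ V] [FiniteDimensional ℝ V]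
  [MeasurableSpace V] [BorelSpace V]

lemma locallyIntegrable_riesz {s : ℝ} (hs : 0 ≤ s) (hsd : s < finrank ℝ V) :
    LocallyIntegrable (fun z : V => ‖z‖ ^ (-s)) := by
  refine locallyIntegrable_of_norm_le_rpow (Nat.cast_pos.1 (hs.trans_lt hsd)) (C := 1) hsd ?_
    (by fun_prop : Measurable fun z : V => ‖z‖ ^ (-s)).aestronglyMeasurable
  filter_upwards with z
  rw [one_mul, Real.norm_of_nonneg (by positivity)]

variable (V) in
/-- The integral of `‖z‖ ^ (-s)` over the unit ball of `V`. -/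
def ballRiesz (s : ℝ) : ℝ := ∫ z in Metric.ball (0 : V) 1, ‖z‖ ^ (-s)

variable (V) in
lemma ballRiesz_nonneg (s : ℝ) : 0 ≤ ballRiesz V s :=
  integral_nonneg fun _ => by positivity

lemma integrable_indicator_ball_riesz {s : ℝ} (hs : 0 ≤ s) (hsd : s < finrank ℝ V) :
    Integrable ((Metric.ball (0 : V) 1).indicator fun z => ‖z‖ ^ (-s)) :=
  (integrable_indicator_iff measurableSet_ball).2 <|
    ((locallyIntegrable_riesz hs hsd).integrableOn_isCompact
      (isCompact_closedBall (0 : V) 1)).mono_set Metric.ball_subset_closedBall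

lemma ballRiesz_mono {s t : ℝ} (ht : 0 ≤ t) (hst : s ≤ t) (htd : t < finrank ℝ V) :
    ballRiesz V s ≤ ballRiesz V t := by
  refine integral_mono_of_nonneg (Eventually.of_forall fun z => by positivity)
    ((integrable_indicator_iff measurableSet_ball).1 (integrable_indicator_ball_riesz ht htd)) ?_
  have : Nontrivial V := Module.nontrivial_of_finrank_pos (R := ℝ)
    (Nat.cast_pos.1 (ht.trans_lt htd))
  filter_upwards [ae_restrict_mem measurableSet_ball,
    ae_restrict_of_ae (compl_mem_ae_iff.2 (measure_singleton (0 : V)))] with z hz hz0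
  exact Real.rpow_le_rpow_of_exponent_ge (norm_pos_iff.2 hz0) (mem_ball_zero_iff.1 hz).le
    (neg_le_neg hst)

lemma integrable_riesz_mul {s : ℝ} (hs : 0 ≤ s) (hsd : s < finrank ℝ V) {f : V → ℂ}
    (hf : Integrable f) {b : ℝ} (hfb : ∀ z, ‖f z‖ ≤ b) (y : V) :
    Integrable fun z => ((‖z - y‖ ^ (-s) : ℝ) : ℂ) * f z := by
  refine ((((integrable_indicator_ball_riesz hs hsd).comp_sub_right y).const_mul b).add
    hf.norm).mono' (AEStronglyMeasurable.mul
      (Measurable.aestronglyMeasurable (by fun_prop)) hf.1) ?_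
  filter_upwards with z
  rw [norm_mul, Complex.norm_real, Real.norm_of_nonneg (by positivity)]
  exact norm_rpow_neg_mul_le_indicator_add hs (norm_nonneg _) (hfb z) (z - y)

lemma integral_riesz_mul_norm_le {s : ℝ} (hs : 0 ≤ s) (hsd : s < finrank ℝ V) {f : V → ℂ}
    (hf : Integrable f) {b : ℝ} (hfb : ∀ z, ‖f z‖ ≤ b) (y : V) :
    ∫ z, ‖z - y‖ ^ (-s) * ‖f z‖ ≤ b * ballRiesz V s + ∫ z, ‖f z‖ := by
  have hball := (integrable_indicator_ball_riesz hs hsd).comp_sub_right y |>.const_mul b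
  refine (integral_mono_of_nonneg (Eventually.of_forall fun z => by positivity)
    (hball.add hf.norm) (Eventually.of_forall fun z =>
      norm_rpow_neg_mul_le_indicator_add hs (norm_nonneg _) (hfb z) (z - y))).trans_eq ?_
  simp only [Pi.add_apply]
  rw [integral_add hball hf.norm, integral_const_mul, integral_sub_right_eq_self
    (fun z : V => (Metric.ball (0 : V) 1).indicator (fun z => ‖z‖ ^ (-s)) z) y,
    integral_indicator measurableSet_ball, ballRiesz]

lemma norm_fourier_le (f : V → ℂ) (k : V) : ‖𝓕 f k‖ ≤ ∫ z, ‖f z‖ :=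
  VectorFourier.norm_fourierIntegral_le_integral_norm _ _ _ _ _

lemma norm_fourierInv_le (f : V → ℂ) (k : V) : ‖𝓕⁻ f k‖ ≤ ∫ z, ‖f z‖ :=
  VectorFourier.norm_fourierIntegral_le_integral_norm _ _ _ _ _

lemma continuous_fourier {f : V → ℂ} (hf : Integrable f) : Continuous (𝓕 f) :=
  VectorFourier.fourierIntegral_continuous Real.continuous_fourierChar
    (by simpa using continuous_inner) hf

lemma continuous_of_fourier_eq {f g : V → ℝ} (hf : Integrable f)
    (hfg : ∀ k, 𝓕 (fun x => (f x : ℂ)) k = g k) : Continuous g := by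
  simpa only [Function.comp_def, hfg, Complex.ofReal_re] using
    Complex.continuous_re.comp (continuous_fourier (f := fun x => (f x : ℂ)) hf.ofReal)

lemma continuous_fourierInv {f : V → ℂ} (hf : Integrable f) : Continuous (𝓕⁻ f) := by
  rw [funext (Real.fourierInv_eq_fourier_neg f)]
  exact (continuous_fourier hf).comp continuous_neg

lemma integral_fourier_mul_eq {f g : V → ℂ} (hf : Integrable f) (hg : Integrable g) :
    ∫ k, 𝓕 f k * g k = ∫ x, f x * 𝓕 g x := by
  have hflip := VectorFourier.integral_fourierIntegral_smul_eq_flip (μ := volume) (ν := volume)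
    (L := innerₗ V) Real.continuous_fourierChar (by simpa using continuous_inner) hf hg
  rwa [flip_innerₗ] at hflip

lemma integral_fourierInv_mul_eq {f g : V → ℂ} (hf : Integrable f) (hg : Integrable g) :
    ∫ k, 𝓕⁻ f k * g k = ∫ x, f x * 𝓕⁻ g x := by
  rw [Real.fourierInv_eq_fourier_comp_neg, integral_fourier_mul_eq hf.comp_neg hg,
    ← integral_neg_eq_self]
  simp only [neg_neg, Real.fourierInv_eq_fourier_neg]

lemma fourier_gaussian_eq {t : ℝ} (ht : 0 < t) (k : V) :
    𝓕 (fun z : V => (Real.exp (-(Real.pi * t⁻¹ * ‖z‖ ^ 2)) : ℂ)) k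
      = ((t ^ ((finrank ℝ V : ℝ) / 2) : ℝ) : ℂ) *
        (Real.exp (-(Real.pi * t * ‖k‖ ^ 2)) : ℂ) := by
  have hre : 0 < ((Real.pi * t⁻¹ : ℝ) : ℂ).re := by
    rw [Complex.ofReal_re]; positivity
  have hpi : (Real.pi : ℂ) ≠ 0 := by exact_mod_cast Real.pi_ne_zero
  have ht' : (t : ℂ) ≠ 0 := by exact_mod_cast ht.ne'
  have hgauss : (fun z : V => (Real.exp (-(Real.pi * t⁻¹ * ‖z‖ ^ 2)) : ℂ))
      = fun z => Complex.exp (-((Real.pi * t⁻¹ : ℝ) : ℂ) * ‖z‖ ^ 2) := by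
    ext z; push_cast; ring_nf
  rw [hgauss, fourier_gaussian_innerProductSpace hre, Complex.ofReal_cpow ht.le,
    Complex.ofReal_exp]
  congr 2 <;> push_cast <;> field_simp

lemma integrable_gaussian {t : ℝ} (ht : 0 < t) :
    Integrable fun z : V => Real.exp (-(Real.pi * t * ‖z‖ ^ 2)) := by
  have hre : 0 < ((Real.pi * t : ℝ) : ℂ).re := by
    rw [Complex.ofReal_re]; positivity
  refine ((GaussianFourier.integrable_cexp_neg_mul_sq_norm_add hre 0 (0 : V)).norm).congr ?_
  filter_upwards with z
  rw [Complex.norm_exp]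
  norm_cast
  simp

lemma integral_gaussian_mul_eq {A : V → ℂ} (hA : Integrable A) {t : ℝ} (ht : 0 < t) :
    ∫ z, (Real.exp (-(Real.pi * t * ‖z‖ ^ 2)) : ℂ) * A z
      = ((t ^ (-(finrank ℝ V : ℝ) / 2) : ℝ) : ℂ) *
        ∫ k, (Real.exp (-(Real.pi * t⁻¹ * ‖k‖ ^ 2)) : ℂ) * 𝓕 A k := by
  have hg : Integrable fun k : V => (Real.exp (-(Real.pi * t⁻¹ * ‖k‖ ^ 2)) : ℂ) :=
    (integrable_gaussian (inv_pos.2 ht)).ofReal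
  have hflip := integral_fourier_mul_eq hg hA
  simp_rw [fourier_gaussian_eq ht, mul_assoc (Complex.ofReal _), integral_const_mul] at hflip
  rw [← hflip, ← mul_assoc, ← Complex.ofReal_mul, ← Real.rpow_add ht]
  simp [neg_div]

/-- The factor `π ^ (-s/2) Γ(s/2)` relating Gaussian superpositions to the power `r ^ (-s)`. -/
def gammaFactor (s : ℝ) : ℝ := Real.pi ^ (-s / 2) * Gamma (s / 2)

lemma gammaFactor_pos {s : ℝ} (hs : 0 < s) : 0 < gammaFactor s :=
  mul_pos (Real.rpow_pos_of_pos Real.pi_pos _) (Real.Gamma_pos_of_pos (half_pos hs))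

lemma integral_rpow_mul_exp_neg_mul_sq {s r : ℝ} (hs : 0 < s) (hr : 0 < r) :
    ∫ t in Ioi (0 : ℝ), t ^ (s / 2 - 1) * Real.exp (-(Real.pi * t * r ^ 2))
      = gammaFactor s * r ^ (-s) := by
  have h := Real.integral_rpow_mul_exp_neg_mul_Ioi (a := s / 2) (r := Real.pi * r ^ 2)
    (half_pos hs) (by positivity)
  have hr2 : (r ^ 2) ^ (s / 2) = r ^ s := by
    rw [← Real.rpow_natCast, ← Real.rpow_mul hr.le]
    congr 1
    push_cast
    ring
  have hcomm : ∀ t : ℝ, Real.pi * r ^ 2 * t = Real.pi * t * r ^ 2 := fun t => by ring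
  simp only [hcomm] at h
  rw [h, gammaFactor, one_div, Real.inv_rpow (by positivity),
    Real.mul_rpow Real.pi_pos.le (by positivity), hr2, neg_div, Real.rpow_neg Real.pi_pos.le,
    Real.rpow_neg hr.le]
  field_simp

lemma integrableOn_rpow_mul_exp_neg_mul_sq {s r : ℝ} (hs : 0 < s) (hr : 0 < r) :
    IntegrableOn (fun t : ℝ => t ^ (s / 2 - 1) * Real.exp (-(Real.pi * t * r ^ 2))) (Ioi 0) := by
  refine not_imp_comm.1 integral_undef ?_
  rw [integral_rpow_mul_exp_neg_mul_sq hs hr]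
  exact (mul_pos (gammaFactor_pos hs) (Real.rpow_pos_of_pos hr _)).ne'

lemma integrable_rpow_mul_gaussian_prod [Nontrivial V] {s : ℝ} (hs : 0 < s) {f : V → ℂ}
    (hf : AEStronglyMeasurable f) (hf' : Integrable fun z => ((‖z‖ ^ (-s) : ℝ) : ℂ) * f z) :
    Integrable (fun p : ℝ × V => ((p.1 ^ (s / 2 - 1) *
      Real.exp (-(Real.pi * p.1 * ‖p.2‖ ^ 2)) : ℝ) : ℂ) * f p.2)
      ((volume.restrict (Ioi 0)).prod volume) := by
  have hne : ∀ᵐ z : V, z ≠ 0 := compl_mem_ae_iff.2 (measure_singleton 0)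
  have hmeas : AEStronglyMeasurable (fun p : ℝ × V => ((p.1 ^ (s / 2 - 1) *
      Real.exp (-(Real.pi * p.1 * ‖p.2‖ ^ 2)) : ℝ) : ℂ) * f p.2)
      ((volume.restrict (Ioi 0)).prod volume) :=
    (Measurable.aestronglyMeasurable (by fun_prop)).mul hf.comp_snd
  refine (integrable_prod_iff' hmeas).2 ⟨?_, (hf'.norm.const_mul (gammaFactor s)).congr ?_⟩
  · filter_upwards [hne] with z hz
    exact (integrableOn_rpow_mul_exp_neg_mul_sq hs (norm_pos_iff.2 hz)).ofReal.mul_const _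
  · filter_upwards [hne] with z hz
    simp_rw [norm_mul, Complex.norm_real]
    rw [integral_mul_const, Real.norm_of_nonneg (Real.rpow_nonneg (norm_nonneg z) _),
      ← mul_assoc, ← integral_rpow_mul_exp_neg_mul_sq hs (norm_pos_iff.2 hz)]
    congr 1
    refine setIntegral_congr_fun measurableSet_Ioi fun t (ht : 0 < t) => ?_
    rw [Real.norm_of_nonneg (by positivity)]

lemma integral_rpow_mul_integral_gaussian [Nontrivial V] {s : ℝ} (hs : 0 < s) {f : V → ℂ}
    (hf : AEStronglyMeasurable f) (hf' : Integrable fun z => ((‖z‖ ^ (-s) : ℝ) : ℂ) * f z) :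
    ∫ t in Ioi (0 : ℝ), ((t ^ (s / 2 - 1) : ℝ) : ℂ) *
        ∫ z, (Real.exp (-(Real.pi * t * ‖z‖ ^ 2)) : ℂ) * f z
      = (gammaFactor s : ℂ) * ∫ z, ((‖z‖ ^ (-s) : ℝ) : ℂ) * f z := by
  have hne : ∀ᵐ z : V, z ≠ 0 := compl_mem_ae_iff.2 (measure_singleton 0)
  calc _ = ∫ t in Ioi (0 : ℝ), ∫ z, ((t ^ (s / 2 - 1) *
        Real.exp (-(Real.pi * t * ‖z‖ ^ 2)) : ℝ) : ℂ) * f z := by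
        simp_rw [← integral_const_mul, Complex.ofReal_mul, mul_assoc]
    _ = ∫ z, ∫ t in Ioi (0 : ℝ), ((t ^ (s / 2 - 1) *
        Real.exp (-(Real.pi * t * ‖z‖ ^ 2)) : ℝ) : ℂ) * f z :=
        integral_integral_swap (integrable_rpow_mul_gaussian_prod hs hf hf')
    _ = _ := by
        rw [← integral_const_mul]
        refine integral_congr_ae ?_
        filter_upwards [hne] with z hz
        rw [integral_mul_const, integral_complex_ofReal,
          integral_rpow_mul_exp_neg_mul_sq hs (norm_pos_iff.2 hz), Complex.ofReal_mul, mul_assoc]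

/-- The positive constant `c` such that, in dimension `d`, the Fourier transform of `‖x‖ ^ (-s)` is
`c ‖k‖ ^ (-(d - s))`. -/
def rieszConst (d s : ℝ) : ℝ := gammaFactor (d - s) / gammaFactor s

lemma rieszConst_pos {d s : ℝ} (hs : 0 < s) (hsd : s < d) : 0 < rieszConst d s :=
  div_pos (gammaFactor_pos (sub_pos.2 hsd)) (gammaFactor_pos hs)

lemma integral_rpow_mul_gaussian_duality {A : V → ℂ} (hA : Integrable A) (s : ℝ) :
    ∫ t in Ioi (0 : ℝ), ((t ^ (s / 2 - 1) : ℝ) : ℂ) *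
        ∫ z, (Real.exp (-(Real.pi * t * ‖z‖ ^ 2)) : ℂ) * A z
      = ∫ t in Ioi (0 : ℝ), ((t ^ ((finrank ℝ V - s) / 2 - 1) : ℝ) : ℂ) *
        ∫ k, (Real.exp (-(Real.pi * t * ‖k‖ ^ 2)) : ℂ) * 𝓕 A k := by
  rw [← integral_comp_rpow_Ioi (fun t : ℝ => ((t ^ ((finrank ℝ V - s) / 2 - 1) : ℝ) : ℂ) *
      ∫ k, (Real.exp (-(Real.pi * t * ‖k‖ ^ 2)) : ℂ) * 𝓕 A k) (p := -1) (by norm_num)]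
  refine setIntegral_congr_fun measurableSet_Ioi fun t (ht : 0 < t) => ?_
  rw [integral_gaussian_mul_eq hA ht, Real.rpow_neg_one, Complex.real_smul, ← mul_assoc,
    ← mul_assoc, ← Complex.ofReal_mul, ← Complex.ofReal_mul]
  congr 2
  rw [Real.inv_rpow ht.le, ← Real.rpow_neg ht.le, ← Real.rpow_add ht, abs_neg, abs_one,
    one_mul, ← Real.rpow_add ht]
  congr 1
  ring

theorem integral_riesz_mul_eq {s : ℝ} (hs : 0 < s) (hsd : s < finrank ℝ V) {A : V → ℂ}
    (hc : Continuous A) (hA : Integrable A) (hA' : Integrable (𝓕 A)) :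
    ∫ z, ((‖z‖ ^ (-s) : ℝ) : ℂ) * A z
      = rieszConst (finrank ℝ V) s *
        ∫ k, ((‖k‖ ^ (-(finrank ℝ V - s)) : ℝ) : ℂ) * 𝓕 A k := by
  have : Nontrivial V := Module.nontrivial_of_finrank_pos (R := ℝ) (Nat.cast_pos.1 (hs.trans hsd))
  have hds : 0 < finrank ℝ V - s := sub_pos.2 hsd
  have hAb : ∀ z, ‖A z‖ ≤ ∫ k, ‖𝓕 A k‖ := fun z => by
    rw [← congrFun (hc.fourierInv_fourier_eq hA hA') z]
    exact norm_fourierInv_le _ z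
  have hspace := integrable_riesz_mul hs.le hsd hA hAb 0
  have hfreq := integrable_riesz_mul hds.le (by linarith) hA' (norm_fourier_le A) 0
  simp only [sub_zero] at hspace hfreq
  have hdual := integral_rpow_mul_gaussian_duality hA s
  rw [integral_rpow_mul_integral_gaussian hs hA.1 hspace,
    integral_rpow_mul_integral_gaussian hds hA'.1 hfreq] at hdual
  have hne : (gammaFactor s : ℂ) ≠ 0 := by exact_mod_cast (gammaFactor_pos hs).ne'
  rw [rieszConst, Complex.ofReal_div, div_mul_eq_mul_div, ← hdual, mul_div_cancel_left₀ _ hne]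

/-! ### Fourier symbols of locally integrable kernels -/

/-- The test functions against which locally integrable kernels are paired: continuous functions of
compact support with integrable inverse Fourier transform. Unlike `C_c^∞`, this class contains the
autocorrelations of test functions and is stable under multiplication by inverse Fourier transforms
of integrable functions. -/
structure IsTestFunction (A : V → ℂ) : Prop where
  continuous : Continuous A
  hasCompactSupport : HasCompactSupport A
  integrable_fourierInv : Integrable (𝓕⁻ A)

lemma integrable_kernel_mul {K : V → ℝ} (hK : LocallyIntegrable K) {A : V → ℂ}
    (hc : Continuous A) (hA : HasCompactSupport A) : Integrable fun z => (K z : ℂ) * A z := by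
  simpa only [Complex.real_smul] using hK.integrable_smul_right_of_hasCompactSupport hc hA

lemma fourierInv_mul_convolution_eq {f g : V → ℂ} (hf : Integrable f) (hg : Integrable g) (k : V) :
    𝓕⁻ (f ⋆[ContinuousLinearMap.mul ℂ ℂ, volume] g) k = 𝓕⁻ f k * 𝓕⁻ g k := by
  simp only [Real.fourierInv_eq_fourier_neg, Real.fourier_mul_convolution_eq hf hg]

lemma fourierInv_conj_comp_neg (f : V → ℂ) (k : V) :
    𝓕⁻ (fun x => conj (f (-x))) k = conj (𝓕⁻ f k) := by
  rw [Real.fourierInv_eq', Real.fourierInv_eq', ← integral_conj, ← integral_neg_eq_self]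
  congr with x
  simp [← Complex.exp_conj, Complex.conj_ofNat]

lemma fourierInv_comp_neg (f : V → ℂ) (k : V) : 𝓕⁻ (fun x => f (-x)) k = 𝓕 f k := by
  rw [Real.fourierInv_eq_fourier_comp_neg]
  simp only [neg_neg]

lemma fourierInv_comp_smul {R : ℝ} (hR : 0 < R) (f : V → ℂ) (k : V) :
    𝓕⁻ (fun x => f (R • x)) k = (((R ^ finrank ℝ V)⁻¹ : ℝ) : ℂ) * 𝓕⁻ f (R⁻¹ • k) := by
  rw [Real.fourierInv_eq', Real.fourierInv_eq', ← Complex.real_smul,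
    ← Measure.integral_comp_smul_of_nonneg volume _ R (hR := hR.le)]
  simp only [real_inner_smul_left, real_inner_smul_right, inv_mul_cancel_left₀ hR.ne']

lemma fourierInv_eq_mul_fourierInv_comp_smul {R : ℝ} (hR : 0 < R) (f : V → ℂ) (k : V) :
    𝓕⁻ f k = ((R ^ finrank ℝ V : ℝ) : ℂ) * 𝓕⁻ (fun x => f (R • x)) (R • k) := by
  have hRn : ((R ^ finrank ℝ V : ℝ) : ℂ) ≠ 0 := by exact_mod_cast (pow_pos hR _).ne'
  rw [fourierInv_comp_smul hR, inv_smul_smul₀ hR.ne', Complex.ofReal_inv, mul_inv_cancel_left₀ hRn]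

/-- The autocorrelation `φ * conj (φ (-·))`, the test function arising from the quadratic form of a
translation-invariant kernel at `φ`. -/
def autocorrelation (φ : V → ℂ) : V → ℂ :=
  φ ⋆[ContinuousLinearMap.mul ℂ ℂ, volume] fun x => conj (φ (-x))

lemma fourierInv_autocorrelation {φ : V → ℂ} (hφ : Integrable φ) (k : V) :
    𝓕⁻ (autocorrelation φ) k = ((‖𝓕⁻ φ k‖ ^ 2 : ℝ) : ℂ) := by
  have hφ' : Integrable fun x => conj (φ (-x)) :=
    (Complex.conjCLE.toContinuousLinearMap.integrable_comp hφ).comp_neg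
  rw [autocorrelation, fourierInv_mul_convolution_eq hφ hφ', fourierInv_conj_comp_neg,
    Complex.mul_conj', Complex.ofReal_pow]

namespace IsTestFunction

variable {A : V → ℂ}

lemma integrable (hA : IsTestFunction A) : Integrable A :=
  hA.continuous.integrable_of_hasCompactSupport hA.hasCompactSupport

lemma integrable_fourier (hA : IsTestFunction A) : Integrable (𝓕 A) := by
  simpa only [Real.fourierInv_eq_fourier_neg, neg_neg] using hA.integrable_fourierInv.comp_neg

lemma convolution {f g : V → ℂ} (hf : IsTestFunction f) (hg : Continuous g)
    (hgs : HasCompactSupport g) :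
    IsTestFunction (f ⋆[ContinuousLinearMap.mul ℂ ℂ, volume] g) where
  continuous := hgs.continuous_convolution_right _ hf.continuous.locallyIntegrable hg
  hasCompactSupport := .convolution _ hf.hasCompactSupport hgs
  integrable_fourierInv := by
    have hgi : Integrable g := hg.integrable_of_hasCompactSupport hgs
    rw [funext (fourierInv_mul_convolution_eq hf.integrable hgi)]
    exact hf.integrable_fourierInv.mul_bdd (continuous_fourierInv hgi).aestronglyMeasurable
      (Eventually.of_forall (norm_fourierInv_le g))

lemma of_contDiff {φ : V → ℂ} (hφ : ContDiff ℝ ∞ φ) (hφs : HasCompactSupport φ) :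
    IsTestFunction φ where
  continuous := hφ.continuous
  hasCompactSupport := hφs
  integrable_fourierInv := by
    have := (𝓕⁻ (hφs.toSchwartzMap hφ)).integrable (μ := volume)
    rwa [SchwartzMap.fourierInv_coe] at this

lemma autocorrelation_of_contDiff {φ : V → ℂ} (hφ : ContDiff ℝ ∞ φ) (hφs : HasCompactSupport φ) :
    IsTestFunction (autocorrelation φ) :=
  (of_contDiff hφ hφs).convolution
    (Complex.continuous_conj.comp (hφ.continuous.comp continuous_neg))
    ((hφs.comp_homeomorph (Homeomorph.neg V)).comp_left (map_zero _))

lemma comp_smul (hA : IsTestFunction A) {R : ℝ} (hR : 0 < R) :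
    IsTestFunction fun x => A (R • x) where
  continuous := hA.continuous.comp (continuous_const_smul R)
  hasCompactSupport := hA.hasCompactSupport.comp_smul hR.ne'
  integrable_fourierInv := by
    rw [funext (fourierInv_comp_smul hR A)]
    exact (hA.integrable_fourierInv.comp_smul (inv_ne_zero hR.ne')).const_mul _

end IsTestFunction

lemma integrable_kernel_mul_prod {K : V → ℝ} (hK : LocallyIntegrable K) {f g : V → ℂ}
    (hf : Continuous f) (hfs : HasCompactSupport f) (hg : Continuous g)
    (hgs : HasCompactSupport g) :
    Integrable fun p : V × V => (K p.2 : ℂ) * f p.1 * g (p.1 - p.2) := by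
  have hmeas : AEStronglyMeasurable (fun p : V × V => (K p.2 : ℂ) * f p.1 * g (p.1 - p.2))
      (volume.prod volume) :=
    ((Complex.continuous_ofReal.comp_aestronglyMeasurable hK.aestronglyMeasurable).comp_snd.mul
      (hf.comp continuous_fst).aestronglyMeasurable).mul
      (hg.comp (continuous_fst.sub continuous_snd)).aestronglyMeasurable
  have hconv : Integrable fun z => K z * ∫ x, ‖f x‖ * ‖g (x - z)‖ := by
    have hgs' := hgs.norm.comp_homeomorph (Homeomorph.neg V)
    have := hK.integrable_smul_right_of_hasCompactSupport
      (hgs'.continuous_convolution_right (ContinuousLinearMap.mul ℝ ℝ) (μ := volume)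
        hf.norm.locallyIntegrable (hg.norm.comp continuous_neg))
      (hfs.norm.convolution _ hgs')
    simpa only [convolution_def, ContinuousLinearMap.mul_apply', Function.comp_apply, smul_eq_mul,
      Homeomorph.coe_neg, neg_sub] using this
  refine (integrable_prod_iff' hmeas).2 ⟨Eventually.of_forall fun z => ?_, hconv.norm.congr ?_⟩
  · have : Integrable fun x => f x * g (x - z) :=
      Continuous.integrable_of_hasCompactSupport (by fun_prop) hfs.mul_right
    simpa only [mul_assoc] using this.const_mul (K z : ℂ)
  · refine Eventually.of_forall fun z => ?_
    simp only [norm_mul, Complex.norm_real, mul_assoc, integral_const_mul]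
    rw [Real.norm_of_nonneg (integral_nonneg fun x => by positivity)]

lemma integral_integral_kernel_mul {K : V → ℝ} (hK : LocallyIntegrable K) {f g : V → ℂ}
    (hf : Continuous f) (hfs : HasCompactSupport f) (hg : Continuous g)
    (hgs : HasCompactSupport g) :
    ∫ x, ∫ y, (K (x - y) : ℂ) * f x * g y
      = ∫ z, (K z : ℂ) * (f ⋆[ContinuousLinearMap.mul ℂ ℂ, volume] fun x => g (-x)) z := by
  calc _ = ∫ x, ∫ z, (K z : ℂ) * f x * g (x - z) := by
        congr with x
        rw [← integral_sub_left_eq_self (fun z => (K z : ℂ) * f x * g (x - z)) volume x]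
        simp only [sub_sub_cancel]
    _ = ∫ z, ∫ x, (K z : ℂ) * f x * g (x - z) :=
        integral_integral_swap (integrable_kernel_mul_prod hK hf hfs hg hgs)
    _ = _ := by
        simp only [convolution_def, ContinuousLinearMap.mul_apply', neg_sub, mul_assoc,
          integral_const_mul]

/-- `HasSymbol K σ` says that `σ` is the Fourier transform of the locally integrable kernel `K` in
the sense of distributions. -/
structure HasSymbol (K σ : V → ℝ) : Prop where
  locallyIntegrable : LocallyIntegrable K
  integrable_mul : ∀ {A : V → ℂ}, IsTestFunction A → Integrable fun k => (σ k : ℂ) * 𝓕⁻ A k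
  integral_mul : ∀ {A : V → ℂ}, IsTestFunction A →
    ∫ x, (K x : ℂ) * A x = ∫ k, (σ k : ℂ) * 𝓕⁻ A k

namespace HasSymbol

variable {K K' σ σ' : V → ℝ}

theorem isPositiveDefinite {d : ℕ} {K σ : E d → ℝ} (h : HasSymbol K σ) (hσ : ∀ᵐ k, 0 ≤ σ k) :
    IsPositiveDefinite K := by
  refine ⟨h.locallyIntegrable, fun φ hφ hφs => ?_⟩
  have hφc : Continuous fun y => conj (φ y) := Complex.continuous_conj.comp hφ.continuous
  have hform : ∫ x, ∫ y, (K (x - y) : ℂ) * φ x * conj (φ y)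
      = ((∫ k, σ k * ‖𝓕⁻ φ k‖ ^ 2 : ℝ) : ℂ) := by
    rw [integral_integral_kernel_mul h.locallyIntegrable hφ.continuous hφs hφc
      (hφs.comp_left (map_zero _))]
    refine (h.integral_mul (.autocorrelation_of_contDiff hφ hφs)).trans ?_
    simp only [fourierInv_autocorrelation
      (hφ.continuous.integrable_of_hasCompactSupport hφs), ← Complex.ofReal_mul,
      integral_complex_ofReal]
  rw [hform, Complex.zero_le_real]
  exact integral_nonneg_of_ae (hσ.mono fun k hk => mul_nonneg hk (sq_nonneg _))

lemma add (h : HasSymbol K σ) (h' : HasSymbol K' σ') :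
    HasSymbol (fun x => K x + K' x) (fun k => σ k + σ' k) where
  locallyIntegrable := h.locallyIntegrable.add h'.locallyIntegrable
  integrable_mul hA := by
    simp only [Complex.ofReal_add, add_mul]
    exact (h.integrable_mul hA).add (h'.integrable_mul hA)
  integral_mul hA := by
    simp only [Complex.ofReal_add, add_mul]
    rw [integral_add (h.integrable_mul hA) (h'.integrable_mul hA), integral_add
      (integrable_kernel_mul h.locallyIntegrable hA.continuous hA.hasCompactSupport)
      (integrable_kernel_mul h'.locallyIntegrable hA.continuous hA.hasCompactSupport),
      h.integral_mul hA, h'.integral_mul hA]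

lemma const_mul (h : HasSymbol K σ) (c : ℝ) :
    HasSymbol (fun x => c * K x) (fun k => c * σ k) where
  locallyIntegrable := h.locallyIntegrable.smul c
  integrable_mul hA := by
    simpa only [Complex.ofReal_mul, mul_assoc] using (h.integrable_mul hA).const_mul (c : ℂ)
  integral_mul hA := by
    simp only [Complex.ofReal_mul, mul_assoc, integral_const_mul, h.integral_mul hA]

lemma sub (h : HasSymbol K σ) (h' : HasSymbol K' σ') :
    HasSymbol (fun x => K x - K' x) (fun k => σ k - σ' k) := by
  simpa only [neg_one_mul, ← sub_eq_add_neg] using h.add (h'.const_mul (-1))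

lemma zero : HasSymbol (fun _ : V => (0 : ℝ)) fun _ => 0 where
  locallyIntegrable := locallyIntegrable_zero
  integrable_mul _ := by simp
  integral_mul _ := by simp

lemma sum {ι : Type*} {s : Finset ι} {K σ : ι → V → ℝ} (h : ∀ i ∈ s, HasSymbol (K i) (σ i)) :
    HasSymbol (fun x => ∑ i ∈ s, K i x) (fun k => ∑ i ∈ s, σ i k) := by
  classical
  induction s using Finset.induction_on with
  | empty => simpa only [Finset.sum_empty] using zero
  | insert i s hi ih =>
    simp only [Finset.sum_insert hi]
    exact (h i (Finset.mem_insert_self i s)).add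
      (ih fun j hj => h j (Finset.mem_insert_of_mem hj))

lemma comp_inv_smul (h : HasSymbol K σ) {R : ℝ} (hR : 0 < R) :
    HasSymbol (fun x => K (R⁻¹ • x)) (fun k => R ^ finrank ℝ V * σ (R • k)) where
  locallyIntegrable := by
    refine (locallyIntegrable_iff (X := V)).2 fun k hk => (integrable_indicator_iff
      hk.measurableSet).1 ?_
    have hind := ((integrable_indicator_iff (hk.smul R⁻¹).measurableSet).2
      (h.locallyIntegrable.integrableOn_isCompact (hk.smul R⁻¹))).comp_smul (inv_ne_zero hR.ne')
    refine hind.congr (Eventually.of_forall fun x => ?_)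
    by_cases hx : x ∈ k <;> simp [hx, smul_mem_smul_set_iff₀ (inv_ne_zero hR.ne')]
  integrable_mul {A} hA := by
    refine (((h.integrable_mul (hA.comp_smul hR)).comp_smul hR.ne').const_mul
      (((R ^ finrank ℝ V : ℝ) : ℂ) ^ 2)).congr (Eventually.of_forall fun k => ?_)
    simp only [fourierInv_eq_mul_fourierInv_comp_smul hR A, Complex.ofReal_mul]
    ring
  integral_mul {A} hA := by
    have hKA : ∀ x, (K (R⁻¹ • x) : ℂ) * A x = (K (R⁻¹ • x) : ℂ) * A (R • R⁻¹ • x) := fun x => by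
      rw [smul_inv_smul₀ hR.ne']
    calc ∫ x, (K (R⁻¹ • x) : ℂ) * A x
        = ((R ^ finrank ℝ V : ℝ) : ℂ) * ∫ x, (K x : ℂ) * A (R • x) := by
          simp only [hKA]
          rw [Measure.integral_comp_inv_smul_of_nonneg volume
            (fun x => (K x : ℂ) * A (R • x)) hR.le, Complex.real_smul]
      _ = ((R ^ finrank ℝ V : ℝ) : ℂ) * (((R ^ finrank ℝ V : ℝ) : ℂ) *
            ∫ k, (σ (R • k) : ℂ) * 𝓕⁻ (fun x => A (R • x)) (R • k)) := by
          rw [h.integral_mul (hA.comp_smul hR), ← smul_inv_smul₀ (pow_pos hR (finrank ℝ V)).ne'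
            (∫ k, (σ k : ℂ) * 𝓕⁻ (fun x => A (R • x)) k), ← Measure.integral_comp_smul_of_nonneg
            volume _ R (hR := hR.le), Complex.real_smul]
      _ = _ := by
          simp only [fourierInv_eq_mul_fourierInv_comp_smul hR A, Complex.ofReal_mul,
            mul_mul_mul_comm _ ((σ _ : ℝ) : ℂ), integral_const_mul, mul_assoc]

end HasSymbol

lemma hasSymbol_riesz {s : ℝ} (hs : 0 < s) (hsd : s < finrank ℝ V) :
    HasSymbol (fun x : V => ‖x‖ ^ (-s))
      (fun k => rieszConst (finrank ℝ V) s * ‖k‖ ^ (-(finrank ℝ V - s))) where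
  locallyIntegrable := locallyIntegrable_riesz hs.le hsd
  integrable_mul {A} hA := by
    have := integrable_riesz_mul (by linarith) (by linarith : finrank ℝ V - s < finrank ℝ V)
      hA.integrable_fourierInv (norm_fourierInv_le A) 0
    simpa only [sub_zero, Complex.ofReal_mul, mul_assoc] using
      this.const_mul (rieszConst (finrank ℝ V) s : ℂ)
  integral_mul {A} hA := by
    rw [integral_riesz_mul_eq hs hsd hA.continuous hA.integrable hA.integrable_fourier,
      ← integral_neg_eq_self]
    simp only [norm_neg, ← Real.fourierInv_eq_fourier_neg, Complex.ofReal_mul, mul_assoc,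
      integral_const_mul]

lemma fourierInv_modulate (f : V → ℂ) (k l : V) :
    𝓕⁻ (fun x => 𝐞 (inner ℝ x k) • f x) l = 𝓕⁻ f (k + l) := by
  simp only [Real.fourierInv_eq, smul_smul, ← AddChar.map_add_eq_mul, ← inner_add_right,
    add_comm l]

lemma fourierInv_mul_eq_integral {q m A : V → ℂ} (hm : Integrable m) (hqm : 𝓕⁻ m = q)
    (hA : Integrable A) (k : V) :
    𝓕⁻ (fun x => q x * A x) k = ∫ l, m l * 𝓕⁻ A (k + l) := by
  have hmod : Integrable fun x => 𝐞 (inner ℝ x k) • A x := by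
    simpa only [inner_neg_right, neg_neg] using (Real.fourierIntegral_convergent_iff (-k)).2 hA
  simp only [← fourierInv_modulate]
  rw [← integral_fourierInv_mul_eq hm hmod, Real.fourierInv_eq, hqm]
  simp only [Circle.smul_def, smul_eq_mul, mul_left_comm]

lemma integral_integral_comp_add {F : Type*} [NormedAddCommGroup F] [NormedSpace ℝ F]
    {f : V × V → F} (hf : Integrable f (volume.prod volume)) :
    ∫ k, ∫ l, f (k + l, l) = ∫ k, ∫ l, f (k, l) := by
  have hT := measurePreserving_add_prod (volume : Measure V) volume
  calc ∫ k, ∫ l, f (k + l, l) = ∫ p : V × V, f (p.1 + p.2, p.2) ∂volume.prod volume :=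
        integral_integral (f := fun k l => f (k + l, l)) (hT.integrable_comp_of_integrable hf)
    _ = ∫ p, f p ∂volume.prod volume := by
        conv_rhs => rw [← hT.map_eq]
        exact (integral_map hT.aemeasurable
          (hT.map_eq.symm ▸ hf.aestronglyMeasurable)).symm
    _ = ∫ k, ∫ l, f (k, l) := integral_prod f hf

lemma IsTestFunction.mul {q m A : V → ℂ} (hA : IsTestFunction A) (hm : Integrable m)
    (hqm : 𝓕⁻ m = q) : IsTestFunction fun x => q x * A x where
  continuous := (hqm ▸ continuous_fourierInv hm).mul hA.continuous
  hasCompactSupport := hA.hasCompactSupport.mul_left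
  integrable_fourierInv := by
    rw [funext (fourierInv_mul_eq_integral hm hqm hA.integrable)]
    exact ((measurePreserving_add_prod volume volume).integrable_comp_of_integrable
      (hA.integrable_fourierInv.mul_prod hm)).integral_prod_left.congr (by simp [mul_comm])

namespace HasSymbol

variable {K σ : V → ℝ}

theorem convolution (h : HasSymbol K σ) {q m : V → ℝ} (hq : Continuous q)
    (hqs : HasCompactSupport q) (hm : ∀ k, 𝓕 (fun x => (q x : ℂ)) k = m k) :
    HasSymbol (fun x => ∫ y, q y * K (x - y)) (fun k => m k * σ k) := by
  have hqc : Continuous fun x => (q x : ℂ) := by fun_prop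
  have hqcs : HasCompactSupport fun x => (q x : ℂ) := hqs.comp_left (g := ((↑) : ℝ → ℂ)) rfl
  have htest : ∀ {A : V → ℂ}, IsTestFunction A → IsTestFunction
      (A ⋆[ContinuousLinearMap.mul ℂ ℂ, volume] fun x => (q (-x) : ℂ)) := fun hA =>
    hA.convolution (hqc.comp continuous_neg) (hqcs.comp_homeomorph (Homeomorph.neg V))
  have hsymbol : ∀ {A : V → ℂ}, IsTestFunction A → ∀ k, ((m k * σ k : ℝ) : ℂ) * 𝓕⁻ A k
      = (σ k : ℂ) * 𝓕⁻ (A ⋆[ContinuousLinearMap.mul ℂ ℂ, volume] fun x => (q (-x) : ℂ)) k := by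
    intro A hA k
    have hqi := (hqc.integrable_of_hasCompactSupport hqcs (μ := volume)).comp_neg
    rw [fourierInv_mul_convolution_eq hA.integrable hqi, fourierInv_comp_neg (fun x => (q x : ℂ)),
      hm, Complex.ofReal_mul]
    ring
  refine ⟨?_, fun hA => ?_, fun {A} hA => ?_⟩
  · exact (hqs.continuous_convolution_left (ContinuousLinearMap.mul ℝ ℝ) hq
      h.locallyIntegrable).locallyIntegrable
  · simpa only [hsymbol hA] using h.integrable_mul (htest hA)
  · simp only [hsymbol hA]
    rw [← h.integral_mul (htest hA), ← integral_integral_kernel_mul h.locallyIntegrable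
      hA.continuous hA.hasCompactSupport hqc hqcs]
    congr with x
    rw [← integral_complex_ofReal, ← integral_mul_const]
    congr with y
    push_cast
    ring

theorem mul (h : HasSymbol K σ) {q m : V → ℝ} (hm : Integrable m)
    (hqm : 𝓕⁻ (fun k => (m k : ℂ)) = fun x => (q x : ℂ))
    (hint : ∀ {A : V → ℂ}, IsTestFunction A →
      Integrable fun p : V × V => (σ (p.1 - p.2) : ℂ) * (m p.2 * 𝓕⁻ A p.1)) :
    HasSymbol (fun x => q x * K x) (fun k => ∫ l, m l * σ (k - l)) := by
  have hqc : Continuous q := by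
    have := Complex.continuous_re.comp (continuous_fourierInv (f := fun k => (m k : ℂ)) hm.ofReal)
    simpa only [hqm, Function.comp_def, Complex.ofReal_re] using this
  have hmul : ∀ {A : V → ℂ}, IsTestFunction A → ∀ k, ∫ l, (σ (k - l) : ℂ) * (m l * 𝓕⁻ A k)
      = ((∫ l, m l * σ (k - l) : ℝ) : ℂ) * 𝓕⁻ A k := by
    intro A _ k
    rw [← integral_complex_ofReal, ← integral_mul_const]
    congr with l
    push_cast
    ring
  refine ⟨?_, fun hA => ?_, fun {A} hA => ?_⟩
  · exact h.locallyIntegrable.continuous_smul hqc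
  · simpa only [hmul hA] using (hint hA).integral_prod_left
  · calc ∫ x, ((q x * K x : ℝ) : ℂ) * A x
        = ∫ k, (σ k : ℂ) * 𝓕⁻ (fun x => q x * A x) k := by
          rw [← h.integral_mul (hA.mul hm.ofReal hqm)]
          congr with x
          push_cast
          ring
      _ = ∫ k, ∫ l, (σ k : ℂ) * (m l * 𝓕⁻ A (k + l)) := by
          simp only [fourierInv_mul_eq_integral hm.ofReal hqm hA.integrable, integral_const_mul]
          rfl
      _ = ∫ k, ∫ l, (σ (k - l) : ℂ) * (m l * 𝓕⁻ A k) := by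
          simpa only [add_sub_cancel_right] using integral_integral_comp_add (hint hA)
      _ = _ := by simp only [hmul hA]

end HasSymbol

/-! ### Multipliers of the Riesz kernel -/

lemma HasSymbol.congr_ae {K σ σ' : V → ℝ} (h : HasSymbol K σ) (hσ : σ =ᵐ[volume] σ') :
    HasSymbol K σ' where
  locallyIntegrable := h.locallyIntegrable
  integrable_mul {A} hA := (h.integrable_mul hA).congr (hσ.mono fun k hk => by
    simp only [hk])
  integral_mul {A} hA := (h.integral_mul hA).trans (integral_congr_ae (hσ.mono fun k hk => by
    simp only [hk]))

/-- `HasRieszMultiplier s K p` says that the Fourier transform of the kernel `K` is `p` times the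
Fourier transform of the Riesz kernel `‖x‖ ^ (-s)`. -/
def HasRieszMultiplier (s : ℝ) (K p : V → ℝ) : Prop :=
  HasSymbol K fun k => p k * (rieszConst (finrank ℝ V) s * ‖k‖ ^ (-(finrank ℝ V - s)))

namespace HasRieszMultiplier

variable {s : ℝ} {K K' p p' : V → ℝ}

lemma riesz (hs : 0 < s) (hsd : s < finrank ℝ V) :
    HasRieszMultiplier s (fun x : V => ‖x‖ ^ (-s)) fun _ => 1 := by
  simpa only [HasRieszMultiplier, one_mul] using hasSymbol_riesz hs hsd

lemma add (h : HasRieszMultiplier s K p) (h' : HasRieszMultiplier s K' p') :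
    HasRieszMultiplier s (fun x => K x + K' x) fun k => p k + p' k := by
  simpa only [HasRieszMultiplier, add_mul] using HasSymbol.add h h'

lemma sub (h : HasRieszMultiplier s K p) (h' : HasRieszMultiplier s K' p') :
    HasRieszMultiplier s (fun x => K x - K' x) fun k => p k - p' k := by
  simpa only [HasRieszMultiplier, sub_mul] using HasSymbol.sub h h'

lemma const_mul (h : HasRieszMultiplier s K p) (c : ℝ) :
    HasRieszMultiplier s (fun x => c * K x) fun k => c * p k := by
  simpa only [HasRieszMultiplier, mul_assoc] using HasSymbol.const_mul h c

lemma sum {ι : Type*} {t : Finset ι} {K p : ι → V → ℝ}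
    (h : ∀ i ∈ t, HasRieszMultiplier s (K i) (p i)) :
    HasRieszMultiplier s (fun x => ∑ i ∈ t, K i x) fun k => ∑ i ∈ t, p i k := by
  simpa only [HasRieszMultiplier, Finset.sum_mul] using HasSymbol.sum h

lemma dilate (h : HasRieszMultiplier s K p) {R : ℝ} (hR : 0 < R) :
    HasRieszMultiplier s (fun x => R ^ (-s) * K (R⁻¹ • x)) fun k => p (R • k) := by
  refine ((HasSymbol.comp_inv_smul h hR).const_mul (R ^ (-s))).congr_ae
    (Eventually.of_forall fun k => ?_)
  have hpow : R ^ (-s) * R ^ finrank ℝ V * R ^ (-(finrank ℝ V - s)) = 1 := by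
    rw [← Real.rpow_natCast, ← Real.rpow_add hR, ← Real.rpow_add hR]
    ring_nf
    exact Real.rpow_zero R
  simp only [norm_smul, Real.norm_of_nonneg hR.le, Real.mul_rpow hR.le (norm_nonneg k)]
  linear_combination p (R • k) * rieszConst (finrank ℝ V) s * ‖k‖ ^ (-(finrank ℝ V - s)) * hpow

theorem isPositiveDefinite {d : ℕ} {K p : E d → ℝ} (h : HasRieszMultiplier s K p)
    (hs : 0 < s) (hsd : s < d) (hp : ∀ᵐ k, 0 ≤ p k) : IsPositiveDefinite K :=
  HasSymbol.isPositiveDefinite h (hp.mono fun k hk => mul_nonneg hk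
    (mul_nonneg (rieszConst_pos hs (by simpa using hsd)).le (by positivity)))

theorem isPositiveDefinite_riesz_add_and_sub {d : ℕ} {K p : E d → ℝ}
    (h : HasRieszMultiplier s K p) (hs : 0 < s) (hsd : s < d) {C : ℝ} (hp : ∀ᵐ k, |p k| ≤ C) :
    IsPositiveDefinite (fun x => C * ‖x‖ ^ (-s) + K x) ∧
      IsPositiveDefinite (fun x => C * ‖x‖ ^ (-s) - K x) := by
  have hC := (riesz (V := E d) hs (by simpa using hsd)).const_mul C
  constructor
  · refine (hC.add h).isPositiveDefinite hs hsd (hp.mono fun k hk => ?_)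
    linarith [neg_le_of_abs_le hk]
  · refine (hC.sub h).isPositiveDefinite hs hsd (hp.mono fun k hk => ?_)
    linarith [le_of_abs_le hk]

end HasRieszMultiplier

/-! ### Averages of the Riesz kernel against cutoffs -/

/-- The mean value of the Riesz kernel `‖x - ·‖ ^ (-s)` with respect to the weight `Q`. -/
def rieszAverage (Q : V → ℝ) (s : ℝ) (x : V) : ℝ := (∫ y, Q y)⁻¹ * ∫ y, Q y / ‖x - y‖ ^ s

/-- The difference between the part `(1 - Q) ‖·‖ ^ (-s)` of the Riesz kernel outside the cutoff `Q`
and the average of the Riesz kernel with respect to `Q`. -/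
def rieszError (Q : V → ℝ) (s : ℝ) (x : V) : ℝ := (1 - Q x) / ‖x‖ ^ s - rieszAverage Q s x

lemma rieszAverage_dilate (Q : V → ℝ) (s : ℝ) {R : ℝ} (hR : 0 < R) (x : V) :
    rieszAverage (fun y => Q (R⁻¹ • y)) s x = R ^ (-s) * rieszAverage Q s (R⁻¹ • x) := by
  have hnorm : ∀ y, Q (R⁻¹ • y) / ‖x - y‖ ^ s
      = R ^ (-s) * (Q (R⁻¹ • y) / ‖R⁻¹ • x - R⁻¹ • y‖ ^ s) := fun y => by
    rw [← smul_sub, norm_smul, Real.norm_of_nonneg (inv_nonneg.2 hR.le),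
      Real.mul_rpow (inv_nonneg.2 hR.le) (norm_nonneg _), Real.inv_rpow hR.le, Real.rpow_neg hR.le]
    have := Real.rpow_pos_of_pos hR s
    field_simp
  have hRn := (pow_pos hR (finrank ℝ V)).ne'
  simp only [rieszAverage, hnorm, integral_const_mul]
  rw [Measure.integral_comp_inv_smul_of_nonneg volume Q hR.le,
    Measure.integral_comp_inv_smul_of_nonneg volume (fun y => Q y / ‖R⁻¹ • x - y‖ ^ s) hR.le,
    smul_eq_mul, smul_eq_mul, mul_inv]
  field_simp

lemma div_norm_rpow_dilate {V : Type*} [NormedAddCommGroup V] [NormedSpace ℝ V] (f : V → ℝ)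
    (s : ℝ) {R : ℝ} (hR : 0 < R) (x : V) :
    f (R⁻¹ • x) / ‖x‖ ^ s = R ^ (-s) * (f (R⁻¹ • x) / ‖R⁻¹ • x‖ ^ s) := by
  have := Real.rpow_pos_of_pos hR s
  rw [norm_smul, Real.norm_of_nonneg (inv_nonneg.2 hR.le),
    Real.mul_rpow (inv_nonneg.2 hR.le) (norm_nonneg _), Real.inv_rpow hR.le, Real.rpow_neg hR.le]
  field_simp

lemma rieszError_dilate (Q : V → ℝ) (s : ℝ) {R : ℝ} (hR : 0 < R) (x : V) :
    rieszError (fun y => Q (R⁻¹ • y)) s x = R ^ (-s) * rieszError Q s (R⁻¹ • x) := by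
  rw [rieszError, rieszError, rieszAverage_dilate Q s hR,
    div_norm_rpow_dilate (fun y => 1 - Q y) s hR, mul_sub]

/-- A cutoff function `Q` with Fourier transform `m`: a nonnegative continuous function of compact
support, normalized by `Q 0 = 1`, whose Fourier transform is nonnegative and decays one power
faster than the borderline of integrability. -/
structure IsCutoff (Q m : V → ℝ) : Prop where
  continuous : Continuous Q
  hasCompactSupport : HasCompactSupport Q
  nonneg : ∀ x, 0 ≤ Q x
  apply_zero : Q 0 = 1
  fourier_eq : ∀ k, 𝓕 (fun x => (Q x : ℂ)) k = m k
  fourier_nonneg : ∀ k, 0 ≤ m k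
  decay : ∃ C, ∀ k, ‖k‖ ^ (finrank ℝ V + 1) * m k ≤ C

namespace IsCutoff

variable {Q m : V → ℝ}

lemma integrable (hQ : IsCutoff Q m) : Integrable Q :=
  hQ.continuous.integrable_of_hasCompactSupport hQ.hasCompactSupport

lemma integral_pos (hQ : IsCutoff Q m) : 0 < ∫ x, Q x :=
  hQ.continuous.integral_pos_of_hasCompactSupport_nonneg_nonzero hQ.hasCompactSupport hQ.nonneg
    (x := 0) (by simp [hQ.apply_zero])

lemma fourier_le (hQ : IsCutoff Q m) (k : V) : m k ≤ ∫ x, Q x := by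
  have h := norm_fourier_le (fun x => (Q x : ℂ)) k
  simp only [hQ.fourier_eq, Complex.norm_real, Real.norm_of_nonneg (hQ.nonneg _),
    Real.norm_of_nonneg (hQ.fourier_nonneg _)] at h
  exact h

lemma continuous_fourier (hQ : IsCutoff Q m) : Continuous m :=
  continuous_of_fourier_eq hQ.integrable hQ.fourier_eq

lemma integrable_norm_rpow_mul (hQ : IsCutoff Q m) {e : ℝ} (he : 0 ≤ e) (he1 : e < 1) :
    Integrable fun k => ‖k‖ ^ e * m k := by
  obtain ⟨C, hC⟩ := hQ.decay
  refine ((integrable_one_add_norm (μ := volume) (r := finrank ℝ V + (1 - e))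
    (by linarith)).const_mul (2 ^ finrank ℝ V * ((∫ x, Q x) + C))).mono'
    (AEStronglyMeasurable.mul (by fun_prop : Measurable fun k : V => ‖k‖ ^ e).aestronglyMeasurable
      hQ.continuous_fourier.aestronglyMeasurable) (Eventually.of_forall fun k => ?_)
  have hm := hQ.fourier_nonneg k
  have hk : 0 < 1 + ‖k‖ := by positivity
  rw [Real.norm_of_nonneg (by positivity), Real.rpow_neg hk.le, ← div_eq_mul_inv,
    le_div_iff₀ (by positivity)]
  calc ‖k‖ ^ e * m k * (1 + ‖k‖) ^ (finrank ℝ V + (1 - e))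
      ≤ (1 + ‖k‖) ^ e * m k * (1 + ‖k‖) ^ (finrank ℝ V + (1 - e)) := by
        gcongr
        linarith
    _ = (1 + ‖k‖) ^ (finrank ℝ V + 1) * m k := by
        rw [mul_right_comm, ← Real.rpow_add hk, ← Real.rpow_natCast]
        push_cast
        ring_nf
    _ ≤ 2 ^ finrank ℝ V * (1 ^ (finrank ℝ V + 1) + ‖k‖ ^ (finrank ℝ V + 1)) * m k := by
        gcongr
        exact add_pow_le zero_le_one (norm_nonneg k) (finrank ℝ V + 1)
    _ = 2 ^ finrank ℝ V * (m k + ‖k‖ ^ (finrank ℝ V + 1) * m k) := by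
        rw [one_pow]
        ring
    _ ≤ _ := by
        gcongr
        exacts [hQ.fourier_le k, hC k]

lemma integrable_fourier (hQ : IsCutoff Q m) : Integrable m := by
  simpa only [Real.rpow_zero, one_mul] using hQ.integrable_norm_rpow_mul le_rfl one_pos

lemma fourierInv_eq (hQ : IsCutoff Q m) : 𝓕⁻ (fun k => (m k : ℂ)) = fun x => (Q x : ℂ) := by
  have hc : Continuous fun x => (Q x : ℂ) := Complex.continuous_ofReal.comp hQ.continuous
  have hm : 𝓕 (fun x => (Q x : ℂ)) = fun k => (m k : ℂ) := funext hQ.fourier_eq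
  rw [← hm]
  exact hc.fourierInv_fourier_eq hQ.integrable.ofReal (hm ▸ hQ.integrable_fourier.ofReal)

lemma integral_fourier (hQ : IsCutoff Q m) : ∫ k, m k = 1 := by
  have h := congrFun hQ.fourierInv_eq 0
  rw [Real.fourierInv_eq', hQ.apply_zero] at h
  simp only [inner_zero_right, mul_zero, Complex.ofReal_zero, zero_mul, Complex.exp_zero,
    one_smul, integral_complex_ofReal] at h
  exact_mod_cast h

lemma integrable_riesz_mul_fourier (hQ : IsCutoff Q m) {a : ℝ} (ha : 0 ≤ a)
    (had : a < finrank ℝ V) (k : V) : Integrable fun l => ‖l - k‖ ^ (-a) * m l := by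
  have h := integrable_riesz_mul ha had (f := fun l => (m l : ℂ)) hQ.integrable_fourier.ofReal
    (b := ∫ x, Q x) (fun l => by
      rw [Complex.norm_real, Real.norm_of_nonneg (hQ.fourier_nonneg l)]
      exact hQ.fourier_le l) k
  simpa [← Complex.ofReal_mul] using h.re

lemma integral_riesz_mul_fourier_le (hQ : IsCutoff Q m) {a : ℝ} (ha : 0 ≤ a)
    (had : a < finrank ℝ V) (k : V) :
    ∫ l, ‖l - k‖ ^ (-a) * m l ≤ (∫ x, Q x) * ballRiesz V a + 1 := by
  have h := integral_riesz_mul_norm_le ha had (f := fun l => (m l : ℂ)) hQ.integrable_fourier.ofReal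
    (b := ∫ x, Q x) (fun l => by
      rw [Complex.norm_real, Real.norm_of_nonneg (hQ.fourier_nonneg l)]
      exact hQ.fourier_le l) k
  simpa only [Complex.norm_real, Real.norm_of_nonneg (hQ.fourier_nonneg _), hQ.integral_fourier]
    using h

theorem hasRieszMultiplier_average (hQ : IsCutoff Q m) {s : ℝ} (hs : 0 < s)
    (hsd : s < finrank ℝ V) :
    HasRieszMultiplier s (rieszAverage Q s) fun k => m k / ∫ x, Q x := by
  refine HasSymbol.congr_ae (K := rieszAverage Q s) ?_ (Eventually.of_forall fun k => ?_)
    (σ := fun k => (∫ x, Q x)⁻¹ *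
      (m k * (rieszConst (finrank ℝ V) s * ‖k‖ ^ (-(finrank ℝ V - s)))))
  · have h := ((hasSymbol_riesz hs hsd).convolution hQ.continuous hQ.hasCompactSupport
      hQ.fourier_eq).const_mul (∫ x, Q x)⁻¹
    have hK : rieszAverage Q s = fun x => (∫ y, Q y)⁻¹ * ∫ y, Q y * ‖x - y‖ ^ (-s) :=
      funext fun x => by simp only [rieszAverage, Real.rpow_neg (norm_nonneg _), div_eq_mul_inv]
    rw [hK]
    exact h
  · ring

end IsCutoff

/-- The multiplier of the product of the Riesz kernel `‖x‖ ^ (-s)` with the function of Fourier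
transform `m`, where `a = finrank ℝ V - s`. -/
def rieszRatio (m : V → ℝ) (a : ℝ) (k : V) : ℝ := ‖k‖ ^ a * ∫ l, ‖l - k‖ ^ (-a) * m l

lemma rieszRatio_nonneg {m : V → ℝ} (hm : ∀ k, 0 ≤ m k) (a : ℝ) (k : V) :
    0 ≤ rieszRatio m a k :=
  mul_nonneg (by positivity) (integral_nonneg fun l => mul_nonneg (by positivity) (hm l))

lemma rpow_neg_le_two_rpow {a r : ℝ} (ha : 0 ≤ a) (hr : 1 / 2 ≤ r) : r ^ (-a) ≤ 2 ^ a := by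
  have hr0 : 0 < r := by linarith
  rw [Real.rpow_neg hr0.le, ← Real.inv_rpow hr0.le]
  gcongr
  rw [inv_le_comm₀ hr0 two_pos]
  linarith

lemma abs_log_le_two_mul {r : ℝ} (hr : 1 / 2 ≤ r) : |Real.log r| ≤ 2 * |r - 1| := by
  have hr0 : 0 < r := by linarith
  have hinv : -(2 * |r - 1|) ≤ 1 - r⁻¹ := by
    rw [show 1 - r⁻¹ = (r - 1) / r by field_simp, le_div_iff₀ hr0]
    nlinarith [neg_abs_le (r - 1), abs_nonneg (r - 1)]
  exact abs_le.2 ⟨hinv.trans (Real.one_sub_inv_le_log_of_pos hr0),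
    by linarith [Real.log_le_sub_one_of_pos hr0, le_abs_self (r - 1), abs_nonneg (r - 1)]⟩

lemma abs_rpow_neg_sub_one_le_mul {a r : ℝ} (ha : 0 ≤ a) (hr : 1 / 2 ≤ r) :
    |r ^ (-a) - 1| ≤ 2 ^ a * (2 * a) * |r - 1| := by
  have hexp := rpow_neg_le_two_rpow ha hr
  rw [Real.rpow_def_of_pos (by linarith)] at hexp ⊢
  set u := Real.log r * -a
  have hu : |u| ≤ 2 * a * |r - 1| := by
    rw [abs_mul, abs_neg, abs_of_nonneg ha]
    nlinarith [abs_log_le_two_mul hr]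
  have hlower : u ≤ Real.exp u - 1 := by linarith [Real.add_one_le_exp u]
  have hupper : Real.exp u - 1 ≤ u * Real.exp u := by
    have h := mul_le_mul_of_nonneg_right (Real.add_one_le_exp (-u)) (Real.exp_nonneg u)
    rw [← Real.exp_add, neg_add_cancel, Real.exp_zero] at h
    linarith
  have h2a : (1 : ℝ) ≤ 2 ^ a := Real.one_le_rpow one_le_two ha
  calc |Real.exp u - 1| ≤ |u| * 2 ^ a := abs_le.2
        ⟨by nlinarith [neg_abs_le u, abs_nonneg u],
          hupper.trans (mul_le_mul (le_abs_self u) hexp (Real.exp_nonneg u) (abs_nonneg u))⟩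
    _ ≤ 2 * a * |r - 1| * 2 ^ a := by gcongr
    _ = 2 ^ a * (2 * a) * |r - 1| := by ring

lemma abs_rpow_neg_sub_one_le_mul_rpow {a r e : ℝ} (ha : 0 ≤ a) (hr : r = 0 ∨ 1 / 2 ≤ r)
    (he : 0 ≤ e) (he1 : e ≤ 1) : |r ^ (-a) - 1| ≤ 2 ^ a * (1 + 2 * a) * |r - 1| ^ e := by
  have h2a : (1 : ℝ) ≤ 2 ^ a := Real.one_le_rpow one_le_two ha
  have hr0 : 0 ≤ r := by rcases hr with rfl | hr <;> linarith
  have hbdd : |r ^ (-a) - 1| ≤ 2 ^ a := by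
    have hle : r ^ (-a) ≤ 2 ^ a := by
      rcases hr with rfl | hr
      · exact Real.zero_rpow_le_one _ |>.trans h2a
      · exact rpow_neg_le_two_rpow ha hr
    exact abs_le.2 ⟨by linarith [Real.rpow_nonneg hr0 (-a)], by linarith⟩
  rcases lt_or_ge |r - 1| 1 with h | h
  · have hr' : 1 / 2 ≤ r := hr.resolve_left fun h0 => by simp [h0] at h
    have hpow := Real.rpow_le_rpow_of_exponent_ge' (abs_nonneg (r - 1)) h.le he he1
    rw [Real.rpow_one] at hpow
    calc |r ^ (-a) - 1| ≤ 2 ^ a * (2 * a) * |r - 1| := abs_rpow_neg_sub_one_le_mul ha hr'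
      _ ≤ 2 ^ a * (1 + 2 * a) * |r - 1| ^ e := by
          gcongr
          linarith
  · calc |r ^ (-a) - 1| ≤ 2 ^ a * (1 + 0) * 1 := by simpa using hbdd
      _ ≤ 2 ^ a * (1 + 2 * a) * |r - 1| ^ e := by
          gcongr
          exacts [by positivity, Real.one_le_rpow h he]

namespace IsCutoff

variable {Q m : V → ℝ}

lemma integrable_riesz_mul_fourier_prod (hQ : IsCutoff Q m) {a : ℝ} (ha : 0 ≤ a)
    (had : a < finrank ℝ V) {f : V → ℂ} (hf : Integrable f) :
    Integrable fun p : V × V => ((‖p.1 - p.2‖ ^ (-a) : ℝ) : ℂ) * (m p.2 * f p.1) := by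
  have hnorm : ∀ k l, ‖((‖k - l‖ ^ (-a) : ℝ) : ℂ) * (m l * f k)‖
      = ‖l - k‖ ^ (-a) * m l * ‖f k‖ := fun k l => by
    rw [norm_mul, norm_mul, Complex.norm_real, Complex.norm_real, norm_sub_rev,
      Real.norm_of_nonneg (by positivity), Real.norm_of_nonneg (hQ.fourier_nonneg l), mul_assoc]
  have hmeas : AEStronglyMeasurable
      (fun p : V × V => ((‖p.1 - p.2‖ ^ (-a) : ℝ) : ℂ) * (m p.2 * f p.1))
      (volume.prod volume) :=
    (by fun_prop : Measurable fun p : V × V =>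
        ((‖p.1 - p.2‖ ^ (-a) : ℝ) : ℂ)).aestronglyMeasurable.mul
      (((Complex.continuous_ofReal.comp hQ.continuous_fourier).comp
        continuous_snd).aestronglyMeasurable.mul hf.aestronglyMeasurable.comp_fst)
  refine (integrable_prod_iff hmeas).2 ⟨Eventually.of_forall fun k => ?_, ?_⟩
  · have h := (hQ.integrable_riesz_mul_fourier ha had k).ofReal.mul_const (f k)
    refine h.congr (Eventually.of_forall fun l => ?_)
    simp only [norm_sub_rev k l, RCLike.ofReal_mul, mul_assoc]
    rfl
  · simp only [hnorm, integral_mul_const]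
    refine (hf.norm.const_mul ((∫ x, Q x) * ballRiesz V a + 1)).mono'
      ?_ (Eventually.of_forall fun k => ?_)
    · have h := hmeas.norm.integral_prod_right'
      simpa only [hnorm, integral_mul_const] using h
    · have h := integral_nonneg (μ := volume) (f := fun l => ‖l - k‖ ^ (-a) * m l) fun l =>
        mul_nonneg (Real.rpow_nonneg (norm_nonneg (l - k)) (-a)) (hQ.fourier_nonneg l)
      rw [Real.norm_of_nonneg (mul_nonneg h (norm_nonneg _))]
      gcongr
      exact hQ.integral_riesz_mul_fourier_le ha had k

theorem hasRieszMultiplier_mul (hQ : IsCutoff Q m) {s : ℝ} (hs : 0 < s)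
    (hsd : s < finrank ℝ V) :
    HasRieszMultiplier s (fun x => Q x / ‖x‖ ^ s) (rieszRatio m (finrank ℝ V - s)) := by
  have : Nontrivial V := Module.nontrivial_of_finrank_pos (R := ℝ) (by exact_mod_cast hs.trans hsd)
  have had : (finrank ℝ V - s : ℝ) < finrank ℝ V := by linarith
  have hsymm : ∀ k l, ‖k - l‖ ^ (-(finrank ℝ V - s)) * m l
      = ‖l - k‖ ^ (-(finrank ℝ V - s)) * m l := fun k l => by rw [norm_sub_rev]
  have h := (hasSymbol_riesz hs hsd).mul hQ.integrable_fourier hQ.fourierInv_eq (fun {A} hA => by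
    have hint := hQ.integrable_riesz_mul_fourier_prod (sub_nonneg.2 hsd.le) had
      hA.integrable_fourierInv
    simpa only [Complex.ofReal_mul, mul_assoc] using
      hint.const_mul (rieszConst (finrank ℝ V) s : ℂ))
  simp only [Real.rpow_neg (norm_nonneg _) s, ← div_eq_mul_inv] at h
  refine h.congr_ae ((Measure.ae_ne volume (0 : V)).mono fun k hk => ?_)
  have := Real.rpow_pos_of_pos (norm_pos_iff.2 hk) (finrank ℝ V - s)
  have hσ : ∀ l, m l * (rieszConst (finrank ℝ V) s * ‖k - l‖ ^ (-(finrank ℝ V - s)))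
      = rieszConst (finrank ℝ V) s * (‖l - k‖ ^ (-(finrank ℝ V - s)) * m l) := fun l => by
    rw [← hsymm]
    ring
  simp only [hσ, integral_const_mul, rieszRatio]
  rw [Real.rpow_neg (norm_nonneg k)]
  field_simp

theorem hasRieszMultiplier_error (hQ : IsCutoff Q m) {s : ℝ} (hs : 0 < s)
    (hsd : s < finrank ℝ V) :
    HasRieszMultiplier s (rieszError Q s)
      fun k => 1 - rieszRatio m (finrank ℝ V - s) k - m k / ∫ x, Q x := by
  have h := ((HasRieszMultiplier.riesz hs hsd).sub (hQ.hasRieszMultiplier_mul hs hsd)).sub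
    (hQ.hasRieszMultiplier_average hs hsd)
  have hK : rieszError Q s = fun x => ‖x‖ ^ (-s) - Q x / ‖x‖ ^ s - rieszAverage Q s x :=
    funext fun x => by rw [rieszError, sub_div, one_div, Real.rpow_neg (norm_nonneg x)]
  rwa [hK]

lemma rieszRatio_le (hQ : IsCutoff Q m) {a b : ℝ} (ha : 0 ≤ a) (hab : a ≤ b)
    (hb : b < finrank ℝ V) (k : V) :
    rieszRatio m a k ≤ ((∫ x, Q x) * ballRiesz V b + 1) * ‖k‖ ^ a := by
  rw [rieszRatio, mul_comm]
  gcongr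
  refine (hQ.integral_riesz_mul_fourier_le ha (hab.trans_lt hb) k).trans ?_
  have := hQ.integral_pos.le
  gcongr
  exact ballRiesz_mono (ha.trans hab) hab hb

lemma abs_one_sub_fourier_div_le (hQ : IsCutoff Q m) (k : V) :
    |1 - m k / ∫ x, Q x| ≤ 2 * Real.pi * (∫ x, ‖x‖ * Q x) / (∫ x, Q x) * ‖k‖ := by
  have hI := hQ.integral_pos
  have hQi : Integrable fun x => (Q x : ℂ) := hQ.integrable.ofReal
  have hxQ : Integrable fun x => ‖x‖ * Q x :=
    (continuous_norm.mul hQ.continuous).integrable_of_hasCompactSupport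
      hQ.hasCompactSupport.mul_left
  have hdiff : ((∫ x, Q x) - m k : ℂ)
      = ∫ x, (1 - Complex.exp (↑(-2 * Real.pi * inner ℝ x k) * Complex.I)) * Q x := by
    simp only [sub_mul, one_mul]
    rw [← hQ.fourier_eq, Real.fourier_eq', integral_sub hQi, integral_complex_ofReal]
    · rfl
    · refine hQi.bdd_mul (c := 1) (by fun_prop) (Eventually.of_forall fun x => ?_)
      rw [Complex.norm_exp_ofReal_mul_I]
  have hbound : |(∫ x, Q x) - m k| ≤ 2 * Real.pi * ‖k‖ * ∫ x, ‖x‖ * Q x := by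
    rw [← Real.norm_eq_abs, ← Complex.norm_real, Complex.ofReal_sub, hdiff, ← integral_const_mul]
    refine norm_integral_le_of_norm_le (hxQ.const_mul _) (Eventually.of_forall fun x => ?_)
    rw [norm_mul, Complex.norm_real, Real.norm_of_nonneg (hQ.nonneg x), norm_sub_rev,
      mul_comm _ Complex.I]
    calc _ ≤ ‖-2 * Real.pi * inner ℝ x k‖ * Q x := by
          gcongr
          · exact hQ.nonneg x
          · exact Real.norm_exp_I_mul_ofReal_sub_one_le
      _ ≤ 2 * Real.pi * (‖x‖ * ‖k‖) * Q x := by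
          rw [norm_mul, norm_mul, norm_neg, Real.norm_two, Real.norm_of_nonneg Real.pi_pos.le]
          gcongr
          exacts [hQ.nonneg x, norm_inner_le_norm x k]
      _ = _ := by ring
  rw [one_sub_div hI.ne', abs_div, abs_of_pos hI, div_mul_eq_mul_div]
  gcongr
  linarith

lemma fourier_le_of_norm_le_two_mul (hQ : IsCutoff Q m) {C : ℝ}
    (hC : ∀ l, ‖l‖ ^ (finrank ℝ V + 1) * m l ≤ C) {k l : V} (hk : 0 < ‖k‖)
    (hkl : ‖k‖ ≤ 2 * ‖l‖) :
    m l ≤ 2 ^ (finrank ℝ V + 1) * C / ‖k‖ ^ (finrank ℝ V + 1) := by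
  have hm := hQ.fourier_nonneg l
  rw [le_div_iff₀ (by positivity), mul_comm]
  calc ‖k‖ ^ (finrank ℝ V + 1) * m l ≤ (2 * ‖l‖) ^ (finrank ℝ V + 1) * m l := by gcongr
    _ = 2 ^ (finrank ℝ V + 1) * (‖l‖ ^ (finrank ℝ V + 1) * m l) := by rw [mul_pow, mul_assoc]
    _ ≤ _ := by
        gcongr
        exact hC l

lemma abs_rpow_neg_sub_one_mul_le (hQ : IsCutoff Q m) {C : ℝ}
    (hC : ∀ l, ‖l‖ ^ (finrank ℝ V + 1) * m l ≤ C) {a e : ℝ} (ha : 0 ≤ a) (he : 0 ≤ e)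
    (he1 : e ≤ 1) {k : V} (hk : k ≠ 0) (l : V) :
    |(‖l - k‖ / ‖k‖) ^ (-a) - 1| * m l ≤ 2 ^ a * (1 + 2 * a) / ‖k‖ ^ e * (‖l‖ ^ e * m l)
      + 2 ^ (finrank ℝ V + 1) * C / ‖k‖ ^ (finrank ℝ V + 1)
        * (Metric.ball (0 : V) 1).indicator (fun z => ‖z‖ ^ (-a)) (‖k‖⁻¹ • (l - k)) := by
  have hk0 : 0 < ‖k‖ := norm_pos_iff.2 hk
  have hm := hQ.fourier_nonneg l
  have hC0 : 0 ≤ C := le_trans (by simp) (hC 0)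
  have hdist : |‖l - k‖ / ‖k‖ - 1| ≤ ‖l‖ / ‖k‖ := by
    rw [div_sub_one hk0.ne', abs_div, abs_of_pos hk0]
    gcongr
    simpa using abs_norm_sub_norm_le (l - k) (-k)
  have hnorm : ‖‖k‖⁻¹ • (l - k)‖ = ‖l - k‖ / ‖k‖ := by
    rw [norm_smul, norm_inv, norm_norm, div_eq_inv_mul]
  have hind : 0 ≤ (Metric.ball (0 : V) 1).indicator (fun z => ‖z‖ ^ (-a)) (‖k‖⁻¹ • (l - k)) :=
    indicator_nonneg (fun _ _ => by positivity) _
  by_cases hfar : ‖l - k‖ / ‖k‖ = 0 ∨ 1 / 2 ≤ ‖l - k‖ / ‖k‖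
  · refine le_add_of_le_of_nonneg ?_ (by positivity)
    calc |(‖l - k‖ / ‖k‖) ^ (-a) - 1| * m l
        ≤ 2 ^ a * (1 + 2 * a) * (‖l‖ / ‖k‖) ^ e * m l := by
          gcongr
          refine (abs_rpow_neg_sub_one_le_mul_rpow ha hfar he he1).trans ?_
          gcongr
      _ = _ := by
          rw [Real.div_rpow (norm_nonneg l) hk0.le]
          ring
  · push Not at hfar
    obtain ⟨hne, hnear⟩ := hfar
    have hr : 0 < ‖l - k‖ / ‖k‖ := lt_of_le_of_ne (by positivity) hne.symm
    have hone := Real.one_le_rpow_of_pos_of_le_one_of_nonpos hr (by linarith) (neg_nonpos.2 ha)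
    have hlarge : ‖k‖ ≤ 2 * ‖l‖ := by
      have h := (le_div_iff₀ hk0).1 (show 1 / 2 ≤ ‖l‖ / ‖k‖ by linarith [(abs_le.1 hdist).1])
      linarith
    refine le_add_of_nonneg_of_le (by positivity) ?_
    rw [indicator_of_mem (by rw [mem_ball_zero_iff, hnorm]; linarith), hnorm,
      abs_of_nonneg (by linarith), mul_comm]
    exact mul_le_mul (hQ.fourier_le_of_norm_le_two_mul hC hk0 hlarge) (by linarith) (by linarith)
      (by positivity)

lemma rieszRatio_sub_one_eq (hQ : IsCutoff Q m) {a : ℝ} (ha : 0 ≤ a) (had : a < finrank ℝ V)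
    (k : V) : rieszRatio m a k - 1 = ∫ l, ((‖l - k‖ / ‖k‖) ^ (-a) - 1) * m l := by
  have hscale : ∀ l, ((‖l - k‖ / ‖k‖) ^ (-a) - 1) * m l
      = ‖k‖ ^ a * (‖l - k‖ ^ (-a) * m l) - m l := fun l => by
    rw [Real.div_rpow (norm_nonneg _) (norm_nonneg _), Real.rpow_neg (norm_nonneg k),
      div_inv_eq_mul]
    ring
  simp only [hscale]
  rw [integral_sub ((hQ.integrable_riesz_mul_fourier ha had k).const_mul _) hQ.integrable_fourier,
    integral_const_mul, hQ.integral_fourier, rieszRatio]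

theorem exists_abs_rieszRatio_sub_one_le (hQ : IsCutoff Q m) {b e : ℝ} (hb0 : 0 ≤ b)
    (hb : b < finrank ℝ V) (he : 0 ≤ e) (he1 : e < 1) :
    ∃ C, 0 ≤ C ∧ ∀ a, 0 ≤ a → a ≤ b → ∀ k, 1 ≤ ‖k‖ →
      |rieszRatio m a k - 1| ≤ C * (‖k‖ ^ e)⁻¹ := by
  obtain ⟨C, hC⟩ := hQ.decay
  have hC0 : 0 ≤ C := le_trans (by simp) (hC 0)
  set N := ∫ l, ‖l‖ ^ e * m l with hN
  have hN0 : 0 ≤ N := integral_nonneg fun l => mul_nonneg (by positivity) (hQ.fourier_nonneg l)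
  have hβ := ballRiesz_nonneg V b
  refine ⟨2 ^ b * (1 + 2 * b) * N + 2 ^ (finrank ℝ V + 1) * C * ballRiesz V b, by positivity,
    fun a ha hab k hk => ?_⟩
  have hk0 : 0 < ‖k‖ := by linarith
  have had := hab.trans_lt hb
  have hfar := (hQ.integrable_norm_rpow_mul he he1).const_mul (2 ^ a * (1 + 2 * a) / ‖k‖ ^ e)
  have hnear := (((integrable_indicator_ball_riesz ha had).comp_smul
    (inv_ne_zero hk0.ne')).comp_sub_right k).const_mul
      (2 ^ (finrank ℝ V + 1) * C / ‖k‖ ^ (finrank ℝ V + 1))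
  have hball : ∫ l, (Metric.ball (0 : V) 1).indicator (fun z => ‖z‖ ^ (-a)) (‖k‖⁻¹ • (l - k))
      = ‖k‖ ^ finrank ℝ V * ballRiesz V a := by
    rw [integral_sub_right_eq_self (fun l => (Metric.ball (0 : V) 1).indicator
      (fun z => ‖z‖ ^ (-a)) (‖k‖⁻¹ • l)) k,
      Measure.integral_comp_inv_smul_of_nonneg _ _ hk0.le, smul_eq_mul,
      integral_indicator measurableSet_ball, ballRiesz]
  rw [hQ.rieszRatio_sub_one_eq ha had, ← Real.norm_eq_abs]
  calc _ ≤ ∫ l, (2 ^ a * (1 + 2 * a) / ‖k‖ ^ e * (‖l‖ ^ e * m l)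
        + 2 ^ (finrank ℝ V + 1) * C / ‖k‖ ^ (finrank ℝ V + 1)
          * (Metric.ball (0 : V) 1).indicator (fun z => ‖z‖ ^ (-a)) (‖k‖⁻¹ • (l - k))) :=
        norm_integral_le_of_norm_le (hfar.add hnear) (Eventually.of_forall fun l => by
          rw [norm_mul, Real.norm_eq_abs, Real.norm_of_nonneg (hQ.fourier_nonneg l)]
          exact hQ.abs_rpow_neg_sub_one_mul_le hC ha he he1.le (norm_pos_iff.1 hk0) l)
    _ = 2 ^ a * (1 + 2 * a) * N * (‖k‖ ^ e)⁻¹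
        + 2 ^ (finrank ℝ V + 1) * C * ballRiesz V a * ‖k‖⁻¹ := by
        rw [integral_add hfar hnear, integral_const_mul, integral_const_mul, hball, ← hN,
          pow_succ ‖k‖]
        field_simp
    _ ≤ 2 ^ b * (1 + 2 * b) * N * (‖k‖ ^ e)⁻¹
        + 2 ^ (finrank ℝ V + 1) * C * ballRiesz V b * (‖k‖ ^ e)⁻¹ := by
        gcongr
        · exact one_le_two
        · exact ballRiesz_mono hb0 hab hb
        · simpa using Real.rpow_le_rpow_of_exponent_le hk he1.le
    _ = _ := by ring

lemma exists_multiplier_bounds_of_norm_le_one (hQ : IsCutoff Q m) {b e : ℝ}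
    (hb : b < finrank ℝ V) (he : 0 ≤ e) (he1 : e ≤ 1) :
    ∃ C, 0 ≤ C ∧ ∀ a, e ≤ a → a ≤ b → ∀ k, k ≠ 0 → ‖k‖ ≤ 1 → rieszRatio m a k ≤ C * ‖k‖ ^ e ∧
      |1 - rieszRatio m a k - m k / ∫ x, Q x| ≤ C * ‖k‖ ^ e := by
  have hI := hQ.integral_pos
  set C₁ := (∫ x, Q x) * ballRiesz V b + 1
  have hC₁ : 0 ≤ C₁ := by have := ballRiesz_nonneg V b; positivity
  set C₂ := 2 * Real.pi * (∫ x, ‖x‖ * Q x) / ∫ x, Q x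
  have hC₂ : 0 ≤ C₂ := by
    have := integral_nonneg (μ := volume) (f := fun x => ‖x‖ * Q x)
      fun x => mul_nonneg (norm_nonneg x) (hQ.nonneg x)
    have := Real.pi_pos
    positivity
  refine ⟨C₂ + C₁, by positivity, fun a ha hab k hk hk1 => ?_⟩
  have hk0 : 0 < ‖k‖ := norm_pos_iff.2 hk
  have := Real.rpow_pos_of_pos hk0 e
  have hratio : rieszRatio m a k ≤ C₁ * ‖k‖ ^ e :=
    (hQ.rieszRatio_le (he.trans ha) hab hb k).trans (mul_le_mul_of_nonneg_left
      (Real.rpow_le_rpow_of_exponent_ge hk0 hk1 ha) hC₁)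
  have hfourier : |1 - m k / ∫ x, Q x| ≤ C₂ * ‖k‖ ^ e :=
    (hQ.abs_one_sub_fourier_div_le k).trans (mul_le_mul_of_nonneg_left
      (by simpa using Real.rpow_le_rpow_of_exponent_ge hk0 hk1 he1) hC₂)
  refine ⟨hratio.trans (by gcongr; linarith), ?_⟩
  rw [sub_right_comm, add_mul]
  refine (abs_sub _ _).trans (add_le_add hfourier ?_)
  rwa [abs_of_nonneg (rieszRatio_nonneg hQ.fourier_nonneg a k)]

lemma exists_multiplier_bounds_of_one_le_norm (hQ : IsCutoff Q m) {b e : ℝ} (hb0 : 0 ≤ b)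
    (hb : b < finrank ℝ V) (he : 0 ≤ e) (he1 : e < 1) :
    ∃ C, 0 ≤ C ∧ ∀ a, e ≤ a → a ≤ b → ∀ k, 1 ≤ ‖k‖ → rieszRatio m a k ≤ C ∧
      |1 - rieszRatio m a k - m k / ∫ x, Q x| ≤ C * (‖k‖ ^ e)⁻¹ := by
  obtain ⟨C₁, hC₁, hasymp⟩ := hQ.exists_abs_rieszRatio_sub_one_le hb0 hb he he1
  obtain ⟨C₂, hdecay⟩ := hQ.decay
  have hC₂ : 0 ≤ C₂ := le_trans (by simp) (hdecay 0)
  have hI := hQ.integral_pos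
  set C₃ := C₂ / ∫ x, Q x
  have hC₃ : 0 ≤ C₃ := by positivity
  refine ⟨1 + C₁ + C₃, by positivity, fun a ha hab k hk => ?_⟩
  have hratio := hasymp a (he.trans ha) hab k hk
  have hke : 1 ≤ ‖k‖ ^ e := Real.one_le_rpow hk he
  have hinv : (‖k‖ ^ e)⁻¹ ≤ 1 := inv_le_one_of_one_le₀ hke
  have hfourier : m k / (∫ x, Q x) ≤ C₃ * (‖k‖ ^ e)⁻¹ := by
    have hpow : ‖k‖ ^ e ≤ ‖k‖ ^ (finrank ℝ V + 1) := by
      rw [← Real.rpow_natCast]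
      refine Real.rpow_le_rpow_of_exponent_le hk ?_
      push_cast
      linarith [Nat.cast_nonneg (α := ℝ) (finrank ℝ V)]
    rw [div_mul_eq_mul_div, ← div_eq_mul_inv]
    gcongr
    rw [le_div_iff₀ (by positivity), mul_comm]
    exact (mul_le_mul_of_nonneg_right hpow (hQ.fourier_nonneg k)).trans (hdecay k)
  refine ⟨by nlinarith [le_of_abs_le hratio], ?_⟩
  calc |1 - rieszRatio m a k - m k / ∫ x, Q x|
      ≤ |rieszRatio m a k - 1| + m k / ∫ x, Q x := by
        rw [abs_sub_comm (rieszRatio m a k)]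
        exact (abs_sub _ _).trans_eq
          (by rw [abs_of_nonneg (div_nonneg (hQ.fourier_nonneg k) hI.le)])
    _ ≤ C₁ * (‖k‖ ^ e)⁻¹ + C₃ * (‖k‖ ^ e)⁻¹ := add_le_add hratio hfourier
    _ ≤ (1 + C₁ + C₃) * (‖k‖ ^ e)⁻¹ := by nlinarith [inv_nonneg.2 (zero_le_one.trans hke)]

theorem exists_multiplier_bounds (hQ : IsCutoff Q m) {b e : ℝ} (hb0 : 0 ≤ b)
    (hb : b < finrank ℝ V) (he : 0 ≤ e) (he1 : e < 1) :
    ∃ C, 0 < C ∧ ∀ a, e ≤ a → a ≤ b → ∀ k, k ≠ 0 → rieszRatio m a k ≤ C ∧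
      |1 - rieszRatio m a k - m k / ∫ x, Q x| ≤ C * min (‖k‖ ^ e) (‖k‖ ^ e)⁻¹ := by
  obtain ⟨C₁, hC₁, hlow⟩ := hQ.exists_multiplier_bounds_of_norm_le_one hb he he1.le
  obtain ⟨C₂, hC₂, hhigh⟩ := hQ.exists_multiplier_bounds_of_one_le_norm hb0 hb he he1
  refine ⟨1 + C₁ + C₂, by positivity, fun a ha hab k hk => ?_⟩
  have hke := Real.rpow_pos_of_pos (norm_pos_iff.2 hk) e
  rcases le_total ‖k‖ 1 with h | h
  · obtain ⟨hratio, herror⟩ := hlow a ha hab k hk h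
    have hke1 : ‖k‖ ^ e ≤ 1 := Real.rpow_le_one (norm_nonneg k) h he
    rw [min_eq_left (hke1.trans ((one_le_inv₀ hke).2 hke1))]
    exact ⟨hratio.trans (by nlinarith), herror.trans (by gcongr; linarith)⟩
  · obtain ⟨hratio, herror⟩ := hhigh a ha hab k h
    have hke1 : 1 ≤ ‖k‖ ^ e := Real.one_le_rpow h he
    rw [min_eq_right ((inv_le_one_of_one_le₀ hke1).trans hke1)]
    exact ⟨hratio.trans (by linarith), herror.trans (by gcongr; linarith)⟩

end IsCutoff

/-! ### Lacunary scales -/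

lemma sum_min_inv_le {μ : ℝ} (hμ : 1 < μ) {M : ℕ} (hM : 1 ≤ M) {y : ℕ → ℝ} (h1 : 0 < y 1)
    (hy : ∀ k, 1 ≤ k → k < M → μ * y k ≤ y (k + 1)) :
    ∑ i ∈ Finset.Icc 1 M, min (y i) (y i)⁻¹ ≤ 2 * (μ / (μ - 1)) := by
  obtain ⟨c, hc⟩ : ∃ c, c = 1 / (μ - 1) := ⟨_, rfl⟩
  have hc0 : 0 < c := by rw [hc]; exact one_div_pos.2 (sub_pos.2 hμ)
  have hcμ : c * μ = c + 1 := by rw [hc]; field_simp [(sub_pos.2 hμ).ne']; ring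
  have hK : μ / (μ - 1) = c + 1 := by rw [← hcμ, hc]; ring
  -- The sum is geometric up to the first `y n ≥ 1`; past it, the slack `c * (y n)⁻¹` pays for all
  -- later terms.
  have hpartial : ∀ n, 1 ≤ n → n ≤ M → 0 < y n ∧
      ∑ i ∈ Finset.Icc 1 n, min (y i) (y i)⁻¹ ≤ (c + 1) * y n ∧
      (1 ≤ y n → ∑ i ∈ Finset.Icc 1 n, min (y i) (y i)⁻¹ ≤ 2 * (c + 1) - c * (y n)⁻¹) := by
    intro n hn
    induction n, hn using Nat.le_induction with
    | base =>
      refine fun _ => ⟨h1, ?_, fun h => ?_⟩ <;> rw [Finset.Icc_self, Finset.sum_singleton]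
      · exact (min_le_left _ _).trans (by nlinarith)
      · exact (min_le_right _ _).trans (by nlinarith [inv_le_one_of_one_le₀ h])
    | succ n hn ih =>
      intro hnM
      obtain ⟨hpos, hsmall, hlarge⟩ := ih (by omega)
      have hstep := hy n hn (by omega)
      have hpos' : 0 < y (n + 1) := (mul_pos (by linarith) hpos).trans_le hstep
      refine ⟨hpos', ?_, fun h => ?_⟩ <;> rw [Finset.sum_Icc_succ_top (by omega)]
      · refine (add_le_add hsmall (min_le_left _ _)).trans ?_
        nlinarith
      · refine (add_le_add_right (min_le_right _ _) _).trans ?_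
        rcases le_total (y n) 1 with h' | h'
        · nlinarith [inv_le_one_of_one_le₀ h]
        · have hinv : μ * (y (n + 1))⁻¹ ≤ (y n)⁻¹ := by
            rw [← div_eq_mul_inv, div_le_iff₀ hpos', ← div_eq_inv_mul, le_div_iff₀ hpos]
            exact hstep
          linear_combination hlarge h' + c * hinv - (y (n + 1))⁻¹ * hcμ
  obtain ⟨hpos, hsmall, hlarge⟩ := hpartial M hM le_rfl
  rw [hK]
  rcases le_total (y M) 1 with h | h
  · nlinarith
  · nlinarith [hlarge h, inv_pos.2 hpos]

lemma pos_of_lacunary {μ : ℝ} (hμ : 0 < μ) {M : ℕ} {R : ℕ → ℝ} (h1 : 0 < R 1)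
    (hR : ∀ k, 1 ≤ k → k < M → μ * R k ≤ R (k + 1)) {i : ℕ} (hi : i ∈ Finset.Icc 1 M) :
    0 < R i := by
  obtain ⟨hi, hiM⟩ := Finset.mem_Icc.1 hi
  induction i, hi using Nat.le_induction with
  | base => exact h1
  | succ n hn ih =>
    exact (mul_pos hμ (ih (Finset.mem_Icc.2 ⟨hn, by omega⟩) (by omega))).trans_le
      (hR n hn (by omega))

lemma abs_sum_dilate_le {V : Type*} [NormedAddCommGroup V] [NormedSpace ℝ V] {p : V → ℝ}
    {C e μ : ℝ} (hC : 0 ≤ C) (he : 0 < e)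
    (hp : ∀ k, k ≠ 0 → |p k| ≤ C * min (‖k‖ ^ e) (‖k‖ ^ e)⁻¹) (hμ : 1 < μ) {M : ℕ}
    (hM : 1 ≤ M) {R : ℕ → ℝ} (h1 : 0 < R 1) (hR : ∀ k, 1 ≤ k → k < M → μ * R k ≤ R (k + 1))
    {k : V} (hk : k ≠ 0) :
    |∑ i ∈ Finset.Icc 1 M, p (R i • k)| ≤ C * (2 * (μ ^ e / (μ ^ e - 1))) := by
  have : 0 < ‖k‖ := norm_pos_iff.2 hk
  have hpos : ∀ i ∈ Finset.Icc 1 M, 0 < R i := fun i => pos_of_lacunary (by linarith) h1 hR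
  have hlacunary : ∀ j, 1 ≤ j → j < M →
      μ ^ e * (R j * ‖k‖) ^ e ≤ (R (j + 1) * ‖k‖) ^ e := fun j hj hjM => by
    have := hpos j (Finset.mem_Icc.2 ⟨hj, hjM.le⟩)
    rw [← Real.mul_rpow (by linarith) (by positivity), ← mul_assoc]
    gcongr
    exact hR j hj hjM
  calc |∑ i ∈ Finset.Icc 1 M, p (R i • k)|
      ≤ ∑ i ∈ Finset.Icc 1 M, |p (R i • k)| := Finset.abs_sum_le_sum_abs _ _
    _ ≤ ∑ i ∈ Finset.Icc 1 M, C * min ((R i * ‖k‖) ^ e) ((R i * ‖k‖) ^ e)⁻¹ :=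
        Finset.sum_le_sum fun i hi => by
          simpa only [norm_smul, Real.norm_of_nonneg (hpos i hi).le] using
            hp (R i • k) (smul_ne_zero (hpos i hi).ne' hk)
    _ ≤ C * (2 * (μ ^ e / (μ ^ e - 1))) := by
        rw [← Finset.mul_sum]
        gcongr
        exact sum_min_inv_le (Real.one_lt_rpow hμ he) hM (by have := h1; positivity) hlacunary

namespace IsCutoff

variable {Q m : V → ℝ} {s R : ℝ}

lemma hasRieszMultiplier_average_dilate (hQ : IsCutoff Q m) (hs : 0 < s) (hsd : s < finrank ℝ V)
    (hR : 0 < R) :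
    HasRieszMultiplier s (rieszAverage (fun y => Q (R⁻¹ • y)) s)
      fun k => m (R • k) / ∫ x, Q x := by
  rw [funext (rieszAverage_dilate Q s hR)]
  exact (hQ.hasRieszMultiplier_average hs hsd).dilate hR

lemma hasRieszMultiplier_error_dilate (hQ : IsCutoff Q m) (hs : 0 < s) (hsd : s < finrank ℝ V)
    (hR : 0 < R) :
    HasRieszMultiplier s (rieszError (fun y => Q (R⁻¹ • y)) s)
      fun k => 1 - rieszRatio m (finrank ℝ V - s) (R • k) - m (R • k) / ∫ x, Q x := by
  rw [funext (rieszError_dilate Q s hR)]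
  exact (hQ.hasRieszMultiplier_error hs hsd).dilate hR

lemma hasRieszMultiplier_mul_dilate (hQ : IsCutoff Q m) (hs : 0 < s) (hsd : s < finrank ℝ V)
    (hR : 0 < R) :
    HasRieszMultiplier s (fun x => Q (R⁻¹ • x) / ‖x‖ ^ s)
      fun k => rieszRatio m (finrank ℝ V - s) (R • k) := by
  rw [funext (div_norm_rpow_dilate Q s hR)]
  exact (hQ.hasRieszMultiplier_mul hs hsd).dilate hR

end IsCutoff

/-! ### Frequency decay of Lipschitz functions with nonnegative radial Fourier transform -/

lemma integrable_norm_mul_gaussian :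
    Integrable fun x : V => Real.exp (-(Real.pi * ‖x‖ ^ 2)) * ‖x‖ := by
  refine (integrable_gaussian (V := V) (t := 1 / 2) (by norm_num)).mono'
    (Continuous.aestronglyMeasurable (by fun_prop)) (Eventually.of_forall fun x => ?_)
  have hnorm : ‖x‖ ≤ Real.exp (Real.pi / 2 * ‖x‖ ^ 2) := by
    have := Real.add_one_le_exp (Real.pi / 2 * ‖x‖ ^ 2)
    nlinarith [sq_nonneg (‖x‖ - 1), Real.pi_gt_three]
  rw [Real.norm_of_nonneg (by positivity)]
  calc Real.exp (-(Real.pi * ‖x‖ ^ 2)) * ‖x‖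
      ≤ Real.exp (-(Real.pi * ‖x‖ ^ 2)) * Real.exp (Real.pi / 2 * ‖x‖ ^ 2) := by gcongr
    _ = Real.exp (-(Real.pi * (1 / 2) * ‖x‖ ^ 2)) := by rw [← Real.exp_add]; ring_nf

lemma exp_neg_sub_exp_neg_four_mul_ge {v : ℝ} (h1 : 1 / 4 ≤ v) (h2 : v ≤ 9 / 4) :
    Real.exp (-(9 * Real.pi / 4)) * (1 - Real.exp (-(3 * Real.pi / 4))) ≤
      Real.exp (-(Real.pi * v)) - Real.exp (-(Real.pi * (4 * v))) := by
  have hpi := Real.pi_pos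
  have hfactor : Real.exp (-(Real.pi * v)) - Real.exp (-(Real.pi * (4 * v)))
      = Real.exp (-(Real.pi * v)) * (1 - Real.exp (-(3 * Real.pi * v))) := by
    rw [mul_sub, mul_one, ← Real.exp_add]
    ring_nf
  rw [hfactor]
  have : Real.exp (-(3 * Real.pi / 4)) ≤ 1 := Real.exp_le_one_iff.2 (by linarith)
  gcongr
  · nlinarith
  · nlinarith

section Annulus

variable {f g : V → ℝ} (hf : Integrable f) (hfg : ∀ k, 𝓕 (fun x => (f x : ℂ)) k = g k)
include hf hfg

lemma integrable_gaussian_mul_fourier {t : ℝ} (ht : 0 < t) :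
    Integrable fun k => Real.exp (-(Real.pi * t * ‖k‖ ^ 2)) * g k := by
  have hg := continuous_of_fourier_eq hf hfg
  refine ((integrable_gaussian ht).mul_const (∫ x, ‖f x‖)).mono'
    (Continuous.aestronglyMeasurable (by fun_prop)) (Eventually.of_forall fun k => ?_)
  have hk := norm_fourier_le (fun x => (f x : ℂ)) k
  simp only [hfg, Complex.norm_real] at hk
  rw [norm_mul, Real.norm_of_nonneg (Real.exp_pos _).le]
  gcongr

lemma integral_gaussian_mul_fourier {r : ℝ} (hr : 0 < r) :
    ∫ k, Real.exp (-(Real.pi * (r ^ 2)⁻¹ * ‖k‖ ^ 2)) * g k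
      = ∫ x, Real.exp (-(Real.pi * ‖x‖ ^ 2)) * f (r⁻¹ • x) := by
  have hparseval := integral_gaussian_mul_eq (A := fun x => (f x : ℂ)) hf.ofReal (t := r ^ 2)
    (by positivity)
  simp_rw [hfg, ← Complex.ofReal_mul, integral_complex_ofReal, ← Complex.ofReal_mul,
    Complex.ofReal_inj] at hparseval
  have hpow : (r ^ 2) ^ (-(finrank ℝ V : ℝ) / 2) = (r ^ finrank ℝ V)⁻¹ := by
    rw [← Real.rpow_natCast r 2, ← Real.rpow_mul hr.le, ← Real.rpow_natCast, ← Real.rpow_neg hr.le]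
    congr 1
    push_cast
    ring
  have hscale := Measure.integral_comp_smul_of_nonneg (volume : Measure V)
    (fun x => Real.exp (-(Real.pi * ‖x‖ ^ 2)) * f (r⁻¹ • x)) r (hR := hr.le)
  simp only [norm_smul, Real.norm_of_nonneg hr.le, smul_smul, inv_mul_cancel₀ hr.ne', one_smul,
    mul_pow, ← mul_assoc] at hscale
  rw [hparseval, hpow, smul_eq_mul] at hscale
  exact mul_left_cancel₀ (by positivity) hscale

-- By Parseval the two Gaussian weights sample `f` at scales `1 / r` and `2 / r`; in the difference
-- `f 0` cancels and only the Lipschitz variation remains.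
lemma integral_gaussian_sub_gaussian_mul_fourier_le {L : NNReal} (hL : LipschitzWith L f) {r : ℝ}
    (hr : 0 < r) :
    ∫ k, (Real.exp (-(Real.pi * (r ^ 2)⁻¹ * ‖k‖ ^ 2)) * g k
      - Real.exp (-(Real.pi * ((r / 2) ^ 2)⁻¹ * ‖k‖ ^ 2)) * g k)
      ≤ L / r * ∫ x : V, Real.exp (-(Real.pi * ‖x‖ ^ 2)) * ‖x‖ := by
  have hint : ∀ q : ℝ, 0 < q →
      Integrable fun x => Real.exp (-(Real.pi * ‖x‖ ^ 2)) * f (q⁻¹ • x) := fun q hq =>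
    (hf.comp_smul (inv_pos.2 hq).ne').bdd_mul (c := 1)
      (Continuous.aestronglyMeasurable (by fun_prop))
      (Eventually.of_forall fun x => by
        rw [Real.norm_of_nonneg (Real.exp_pos _).le]
        exact Real.exp_le_one_iff.2 (by have := Real.pi_pos; simp only [neg_nonpos]; positivity))
  rw [integral_sub (integrable_gaussian_mul_fourier hf hfg (by positivity))
    (integrable_gaussian_mul_fourier hf hfg (by positivity)),
    integral_gaussian_mul_fourier hf hfg hr, integral_gaussian_mul_fourier hf hfg (half_pos hr),
    ← integral_sub (hint r hr) (hint (r / 2) (half_pos hr)), ← integral_const_mul]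
  refine integral_mono ((hint r hr).sub (hint (r / 2) (half_pos hr)))
    (integrable_norm_mul_gaussian.const_mul _) fun x => ?_
  have hdist : dist (r⁻¹ • x) ((r / 2)⁻¹ • x) = ‖x‖ / r := by
    rw [dist_eq_norm, ← sub_smul, norm_smul, show r⁻¹ - (r / 2)⁻¹ = -r⁻¹ by field_simp; norm_num,
      norm_neg, norm_inv, Real.norm_of_nonneg hr.le, div_eq_inv_mul]
  calc Real.exp (-(Real.pi * ‖x‖ ^ 2)) * f (r⁻¹ • x)
        - Real.exp (-(Real.pi * ‖x‖ ^ 2)) * f ((r / 2)⁻¹ • x)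
      = Real.exp (-(Real.pi * ‖x‖ ^ 2)) * (f (r⁻¹ • x) - f ((r / 2)⁻¹ • x)) := by ring
    _ ≤ Real.exp (-(Real.pi * ‖x‖ ^ 2)) * (L * (‖x‖ / r)) := by
        gcongr
        exact (le_abs_self _).trans (hdist ▸ hL.dist_le_mul _ _)
    _ = L / r * (Real.exp (-(Real.pi * ‖x‖ ^ 2)) * ‖x‖) := by ring

lemma mul_setIntegral_annulus_le (hg : ∀ k, 0 ≤ g k) {r : ℝ} (hr : 0 < r) :
    Real.exp (-(9 * Real.pi / 4)) * (1 - Real.exp (-(3 * Real.pi / 4))) *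
        ∫ k in {k | ‖k‖ ∈ Icc (r / 2) (3 * r / 2)}, g k
      ≤ ∫ k, (Real.exp (-(Real.pi * (r ^ 2)⁻¹ * ‖k‖ ^ 2)) * g k
        - Real.exp (-(Real.pi * ((r / 2) ^ 2)⁻¹ * ‖k‖ ^ 2)) * g k) := by
  have hint := (integrable_gaussian_mul_fourier hf hfg (t := (r ^ 2)⁻¹) (by positivity)).sub
    (integrable_gaussian_mul_fourier hf hfg (t := ((r / 2) ^ 2)⁻¹) (by positivity))
  have hmeas : MeasurableSet {k : V | ‖k‖ ∈ Icc (r / 2) (3 * r / 2)} :=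
    measurable_norm measurableSet_Icc
  rw [← integral_const_mul]
  refine (integral_mono_of_nonneg (Eventually.of_forall fun k => ?_) hint.integrableOn
    (ae_restrict_of_forall_mem hmeas fun k hk => ?_)).trans
    (setIntegral_le_integral hint (Eventually.of_forall fun k => ?_))
  · have : Real.exp (-(3 * Real.pi / 4)) ≤ 1 :=
      Real.exp_le_one_iff.2 (by linarith [Real.pi_pos])
    exact mul_nonneg (mul_nonneg (Real.exp_pos _).le (sub_nonneg.2 this)) (hg k)
  · simp only [Pi.sub_apply, ← sub_mul]
    have h := exp_neg_sub_exp_neg_four_mul_ge (v := (r ^ 2)⁻¹ * ‖k‖ ^ 2)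
      (by rw [inv_mul_eq_div, le_div_iff₀ (by positivity)]; nlinarith [hk.1])
      (by rw [inv_mul_eq_div, div_le_iff₀ (by positivity)]; nlinarith [hk.2, norm_nonneg k])
    refine mul_le_mul_of_nonneg_right (h.trans_eq ?_) (hg k)
    congr 3 <;> ring
  · simp only [Pi.zero_apply, Pi.sub_apply, ← sub_mul]
    refine mul_nonneg (sub_nonneg.2 (Real.exp_le_exp.2 (neg_le_neg ?_))) (hg k)
    gcongr
    linarith

theorem exists_setIntegral_annulus_le {L : NNReal} (hL : LipschitzWith L f) (hg : ∀ k, 0 ≤ g k) :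
    ∃ C, ∀ r, 0 < r → ∫ k in {k | ‖k‖ ∈ Icc (r / 2) (3 * r / 2)}, g k ≤ C / r := by
  set c := Real.exp (-(9 * Real.pi / 4)) * (1 - Real.exp (-(3 * Real.pi / 4)))
  have hc : 0 < c := mul_pos (Real.exp_pos _)
    (sub_pos.2 (Real.exp_lt_one_iff.2 (by linarith [Real.pi_pos])))
  set J := ∫ x : V, Real.exp (-(Real.pi * ‖x‖ ^ 2)) * ‖x‖
  refine ⟨L * J / c, fun r hr => ?_⟩
  have h := (mul_setIntegral_annulus_le hf hfg hg hr).trans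
    (integral_gaussian_sub_gaussian_mul_fourier_le hf hfg hL hr)
  calc _ ≤ L / r * J / c := (le_div_iff₀' hc).2 h
    _ = L * J / c / r := by ring

end Annulus

lemma setIntegral_norm_mem_eq [Nontrivial V] {A : Set ℝ} (hA : MeasurableSet A) (hA' : A ⊆ Ioi 0)
    (G : ℝ → ℝ) :
    ∫ l in {l : V | ‖l‖ ∈ A}, G ‖l‖ = finrank ℝ V * volume.real (Metric.ball (0 : V) 1) *
      ∫ u in A, u ^ (finrank ℝ V - 1) * G u := by
  have hind : {l : V | ‖l‖ ∈ A}.indicator (fun l => G ‖l‖) = fun l => A.indicator G ‖l‖ :=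
    funext fun l => indicator_comp_right (s := A) (g := G) (fun l : V => ‖l‖)
  have hmul : (fun u => u ^ (finrank ℝ V - 1) • A.indicator G u)
      = A.indicator fun u => u ^ (finrank ℝ V - 1) * G u :=
    funext fun u => (indicator_mul_right A _ G).symm
  have hmeas : MeasurableSet {l : V | ‖l‖ ∈ A} := measurable_norm hA
  rw [← integral_indicator hmeas, hind, integral_fun_norm_addHaar, hmul,
    setIntegral_indicator hA, inter_eq_self_of_subset_right hA', nsmul_eq_mul, smul_eq_mul,
    mul_assoc]

lemma integral_ray_le_setIntegral_annulus {g : V → ℝ} (hc : Continuous g) (hg : ∀ k, 0 ≤ g k)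
    (hrad : ∀ k l, ‖k‖ = ‖l‖ → g k = g l) {k : V} (hk : k ≠ 0) :
    finrank ℝ V * volume.real (Metric.ball (0 : V) 1) * ((‖k‖ / 2) ^ (finrank ℝ V - 1) *
        (‖k‖ * ∫ t in (1 / 2 : ℝ)..(3 / 2), g (t • k)))
      ≤ ∫ l in {l | ‖l‖ ∈ Icc (‖k‖ / 2) (3 * ‖k‖ / 2)}, g l := by
  have : Nontrivial V := ⟨k, 0, hk⟩
  have hr : 0 < ‖k‖ := norm_pos_iff.2 hk
  set G : ℝ → ℝ := fun u => g ((u / ‖k‖) • k)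
  have hG : ∀ l, g l = G ‖l‖ := fun l => hrad _ _ (by
    rw [norm_smul, norm_div, norm_norm, norm_norm, div_mul_cancel₀ _ hr.ne'])
  have hGc : Continuous G := hc.comp (by fun_prop)
  have hray : ‖k‖ * ∫ t in (1 / 2 : ℝ)..(3 / 2), g (t • k)
      = ∫ u in Icc (‖k‖ / 2) (3 * ‖k‖ / 2), G u := by
    have : (fun t : ℝ => g (t • k)) = fun t => G (t * ‖k‖) :=
      funext fun t => by simp only [G, mul_div_cancel_right₀ _ hr.ne']
    rw [this, ← smul_eq_mul, intervalIntegral.smul_integral_comp_mul_right,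
      intervalIntegral.integral_of_le (by nlinarith), integral_Icc_eq_integral_Ioc]
    congr 3 <;> ring
  rw [hray]
  simp only [hG]
  rw [setIntegral_norm_mem_eq measurableSet_Icc fun u hu => (half_pos hr).trans_le hu.1,
    ← integral_const_mul (_ ^ _)]
  refine mul_le_mul_of_nonneg_left (setIntegral_mono_on ?_ ?_ measurableSet_Icc fun u hu => ?_)
    (by positivity)
  · exact (continuous_const.mul hGc).continuousOn.integrableOn_compact isCompact_Icc
  · exact ((continuous_pow _).mul hGc).continuousOn.integrableOn_compact isCompact_Icc
  · exact mul_le_mul_of_nonneg_right (by gcongr; exact hu.1) (hg _)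

theorem exists_norm_pow_mul_integral_ray_le {f g : V → ℝ} (hf : Integrable f)
    (hfg : ∀ k, 𝓕 (fun x => (f x : ℂ)) k = g k) {L : NNReal} (hL : LipschitzWith L f)
    (hg : ∀ k, 0 ≤ g k) (hrad : ∀ k l, ‖k‖ = ‖l‖ → g k = g l) :
    ∃ C, ∀ k, ‖k‖ ^ (finrank ℝ V + 1) * ∫ t in (1 / 2 : ℝ)..(3 / 2), g (t • k) ≤ C := by
  obtain ⟨C, hC⟩ := exists_setIntegral_annulus_le hf hfg hL hg
  set n := finrank ℝ V
  set v := volume.real (Metric.ball (0 : V) 1)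
  refine ⟨|C * 2 ^ (n - 1) / (n * v)|, fun k => ?_⟩
  rcases eq_or_ne k 0 with rfl | hk
  · simp
  have : Nontrivial V := ⟨k, 0, hk⟩
  have hn : 0 < n := Module.finrank_pos
  have hr : 0 < ‖k‖ := norm_pos_iff.2 hk
  have hv : 0 < v :=
    ENNReal.toReal_pos (Metric.measure_ball_pos _ _ one_pos).ne' measure_ball_lt_top.ne
  have h := (integral_ray_le_setIntegral_annulus (continuous_of_fourier_eq hf hfg) hg
    hrad hk).trans (hC _ hr)
  rw [le_div_iff₀ hr] at h
  have hpow : ‖k‖ ^ (n + 1) = 2 ^ (n - 1) * (‖k‖ / 2) ^ (n - 1) * ‖k‖ * ‖k‖ := by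
    rw [← mul_pow, mul_div_cancel₀ _ two_ne_zero, ← pow_succ, ← pow_succ]
    congr 1
    omega
  refine le_trans ?_ (le_abs_self _)
  rw [le_div_iff₀ (by positivity), hpow]
  calc _ = 2 ^ (n - 1) * (n * v * ((‖k‖ / 2) ^ (n - 1) *
        (‖k‖ * ∫ t in (1 / 2 : ℝ)..(3 / 2), g (t • k))) * ‖k‖) := by ring
    _ ≤ 2 ^ (n - 1) * C := by gcongr
    _ = C * 2 ^ (n - 1) := mul_comm _ _

/-! ### Radial averages of dilates -/

namespace IsProfile

variable {η : ℝ} {ρ : ℝ → ℝ}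

lemma mono {η' : ℝ} (hρ : IsProfile η ρ) (hη : η ≤ η') : IsProfile η' ρ where
  __ := hρ
  support_subset := hρ.support_subset.trans (Icc_subset_Icc (by linarith) (by linarith))

lemma eq_zero_of_notMem (hρ : IsProfile η ρ) {t : ℝ} (ht : t ∉ Icc (1 - η) (1 + η)) : ρ t = 0 :=
  image_eq_zero_of_notMem_tsupport fun h => ht (hρ.support_subset h)

lemma hasCompactSupport (hρ : IsProfile η ρ) : HasCompactSupport ρ :=
  isCompact_Icc.of_isClosed_subset (isClosed_tsupport ρ) hρ.support_subset

lemma integrable (hρ : IsProfile η ρ) : Integrable ρ :=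
  hρ.smooth.continuous.integrable_of_hasCompactSupport hρ.hasCompactSupport

lemma half_le_of_ne_zero (hρ : IsProfile (1 / 2) ρ) {t : ℝ} (ht : ρ t ≠ 0) : 1 / 2 ≤ t := by
  linarith [(not_imp_comm.1 hρ.eq_zero_of_notMem ht).1]

lemma le_of_ne_zero (hρ : IsProfile (1 / 2) ρ) {t : ℝ} (ht : ρ t ≠ 0) : t ≤ 3 / 2 := by
  linarith [(not_imp_comm.1 hρ.eq_zero_of_notMem ht).2]

end IsProfile

/-- The average of the dilates `f (x / t)` against the weight `ρ t`. -/
def radialAverage (ρ : ℝ → ℝ) (f : V → ℝ) (x : V) : ℝ := ∫ t, ρ t * f (t⁻¹ • x)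

/-- The Fourier transform of `radialAverage ρ f` when `f` has Fourier transform `g` and `ρ` is
supported in `(0, ∞)`. -/
def radialAverageFourier (ρ : ℝ → ℝ) (g : V → ℝ) (k : V) : ℝ :=
  ∫ t, ρ t * (t ^ finrank ℝ V * g (t • k))

section RadialAverage

variable {ρ : ℝ → ℝ} {f g : V → ℝ}

omit [FiniteDimensional ℝ V] in
lemma continuous_radialAverage (hρ : Integrable ρ) (hf : Continuous f) (hfs : HasCompactSupport f) :
    Continuous (radialAverage ρ f) := by
  obtain ⟨C, hC⟩ := hfs.exists_bound_of_continuous hf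
  refine continuous_of_dominated (bound := fun t => ‖ρ t‖ * C) (fun x => ?_)
    (fun x => Eventually.of_forall fun t => ?_) (hρ.norm.mul_const C)
    (Eventually.of_forall fun t => by fun_prop)
  · have := hf.measurable
    exact hρ.aestronglyMeasurable.mul (Measurable.aestronglyMeasurable (by fun_prop))
  · rw [norm_mul]
    gcongr
    exact hC _

omit [MeasurableSpace V] [BorelSpace V] in
lemma hasCompactSupport_radialAverage (hρ : IsProfile (1 / 2) ρ) (hfs : HasCompactSupport f) :
    HasCompactSupport (radialAverage ρ f) := by
  obtain ⟨a, ha, hfa⟩ := hfs.isCompact.isBounded.subset_closedBall_lt 0 0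
  refine HasCompactSupport.intro (isCompact_closedBall (0 : V) (3 / 2 * a)) fun x hx => ?_
  refine integral_eq_zero_of_ae (Eventually.of_forall fun t => ?_)
  by_cases ht : ρ t = 0
  · simp only [ht, zero_mul, Pi.zero_apply]
  have ht0 : 0 < t := by linarith [hρ.half_le_of_ne_zero ht]
  have hfx : f (t⁻¹ • x) = 0 := image_eq_zero_of_notMem_tsupport fun h => hx (by
    have hxa := mem_closedBall_zero_iff.1 (hfa h)
    rw [norm_smul, norm_inv, Real.norm_of_nonneg ht0.le, inv_mul_le_iff₀ ht0] at hxa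
    exact mem_closedBall_zero_iff.2 (hxa.trans (by gcongr; exact hρ.le_of_ne_zero ht)))
  simp only [hfx, mul_zero, Pi.zero_apply]

lemma fourier_comp_inv_smul {t : ℝ} (ht : 0 < t) (f : V → ℂ) (k : V) :
    𝓕 (fun x => f (t⁻¹ • x)) k = ((t ^ finrank ℝ V : ℝ) : ℂ) * 𝓕 f (t • k) := by
  rw [Real.fourier_eq', Real.fourier_eq', ← Complex.real_smul,
    ← Measure.integral_comp_inv_smul_of_nonneg volume _ ht.le]
  simp only [real_inner_smul_left, real_inner_smul_right, mul_inv_cancel_left₀ ht.ne']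

lemma integrable_radialAverage_prod (hρ : IsProfile (1 / 2) ρ) (hfm : Measurable f)
    (hf : Integrable f) :
    Integrable (fun p : V × ℝ => ρ p.2 * f (p.2⁻¹ • p.1)) (volume.prod volume) := by
  have hρm := hρ.smooth.continuous.measurable
  refine (integrable_prod_iff' (Measurable.aestronglyMeasurable (by fun_prop))).2
    ⟨Eventually.of_forall fun t => ?_, ?_⟩
  · rcases eq_or_ne t 0 with rfl | ht
    · have h0 : ρ 0 = 0 := hρ.eq_zero_of_notMem (by norm_num)
      simp only [h0, zero_mul]
      exact integrable_zero _ _ _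
    · exact (hf.comp_smul (inv_ne_zero ht)).const_mul (ρ t)
  · have hnorm : ∀ t, ∫ x, ‖ρ t * f (t⁻¹ • x)‖ = |t ^ finrank ℝ V| * (∫ x, ‖f x‖) * ‖ρ t‖ := by
      intro t
      simp only [norm_mul]
      rw [integral_const_mul, Measure.integral_comp_inv_smul volume fun x => ‖f x‖, smul_eq_mul,
        mul_comm]
    simp only [hnorm]
    have hρc := hρ.smooth.continuous
    exact Continuous.integrable_of_hasCompactSupport (by fun_prop)
      hρ.hasCompactSupport.norm.mul_left

lemma fourier_radialAverage (hρ : IsProfile (1 / 2) ρ) (hfm : Measurable f) (hf : Integrable f)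
    (hfg : ∀ k, 𝓕 (fun x => (f x : ℂ)) k = g k) (k : V) :
    𝓕 (fun x => (radialAverage ρ f x : ℂ)) k = radialAverageFourier ρ g k := by
  set e : V → ℂ := fun x => Complex.exp (↑(-2 * Real.pi * inner ℝ x k) * Complex.I)
  have hdilate : ∀ t, ∫ x, e x * ((ρ t * f (t⁻¹ • x) : ℝ) : ℂ)
      = ((ρ t * (t ^ finrank ℝ V * g (t • k)) : ℝ) : ℂ) := by
    intro t
    by_cases ht : ρ t = 0
    · simp only [ht, zero_mul, Complex.ofReal_zero, mul_zero, integral_zero]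
    have ht0 : 0 < t := by linarith [hρ.half_le_of_ne_zero ht]
    have h := fourier_comp_inv_smul ht0 (fun x => (f x : ℂ)) k
    rw [Real.fourier_eq', hfg] at h
    simp only [smul_eq_mul] at h
    simp only [Complex.ofReal_mul (ρ t), mul_left_comm (e _)]
    rw [integral_const_mul, h, Complex.ofReal_mul]
  have hint : Integrable (fun p : V × ℝ => e p.1 * ((ρ p.2 * f (p.2⁻¹ • p.1) : ℝ) : ℂ))
      (volume.prod volume) := by
    refine (integrable_radialAverage_prod hρ hfm hf).ofReal.bdd_mul (c := 1)
      (Continuous.aestronglyMeasurable (by fun_prop)) (Eventually.of_forall fun p => ?_)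
    rw [Complex.norm_exp_ofReal_mul_I]
  calc 𝓕 (fun x => (radialAverage ρ f x : ℂ)) k
      = ∫ x, ∫ t, e x * ((ρ t * f (t⁻¹ • x) : ℝ) : ℂ) := by
        simp only [Real.fourier_eq', radialAverage, smul_eq_mul, integral_const_mul,
          integral_complex_ofReal, e]
    _ = ∫ t, ∫ x, e x * ((ρ t * f (t⁻¹ • x) : ℝ) : ℂ) := integral_integral_swap hint
    _ = radialAverageFourier ρ g k := by
        simp only [hdilate, integral_complex_ofReal, radialAverageFourier]

omit [FiniteDimensional ℝ V] [MeasurableSpace V] [BorelSpace V] in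
lemma radialAverageFourier_nonneg (hρ : IsProfile (1 / 2) ρ) (hg : ∀ k, 0 ≤ g k) (k : V) :
    0 ≤ radialAverageFourier ρ g k := by
  refine integral_nonneg fun t => ?_
  by_cases ht : ρ t = 0
  · simp only [ht, zero_mul, Pi.zero_apply, le_refl]
  · have := hρ.half_le_of_ne_zero ht
    exact mul_nonneg (hρ.nonneg t) (mul_nonneg (by positivity) (hg _))

omit [FiniteDimensional ℝ V] [MeasurableSpace V] [BorelSpace V] in
lemma exists_radialAverageFourier_le (hρ : IsProfile (1 / 2) ρ) (hgc : Continuous g)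
    (hg : ∀ k, 0 ≤ g k) :
    ∃ b, 0 ≤ b ∧ ∀ k, radialAverageFourier ρ g k ≤ b * ∫ t in (1 / 2 : ℝ)..(3 / 2), g (t • k) := by
  obtain ⟨b, hb⟩ := hρ.hasCompactSupport.exists_bound_of_continuous hρ.smooth.continuous
  have hb0 : 0 ≤ b := (norm_nonneg _).trans (hb 0)
  refine ⟨b * (3 / 2) ^ finrank ℝ V, by positivity, fun k => ?_⟩
  have hρc := hρ.smooth.continuous
  have hIcc : radialAverageFourier ρ g k
      = ∫ t in Icc (1 / 2) (3 / 2), ρ t * (t ^ finrank ℝ V * g (t • k)) := by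
    refine (setIntegral_eq_integral_of_forall_compl_eq_zero fun t ht => ?_).symm
    rw [hρ.eq_zero_of_notMem (by norm_num at ht ⊢; exact ht), zero_mul]
  rw [hIcc, intervalIntegral.integral_of_le (by norm_num), ← integral_Icc_eq_integral_Ioc,
    ← integral_const_mul]
  refine setIntegral_mono_on (Continuous.integrableOn_Icc (by fun_prop))
    (Continuous.integrableOn_Icc (by fun_prop)) measurableSet_Icc fun t ht => ?_
  have ht0 : 0 ≤ t := by linarith [ht.1]
  have := hg (t • k)
  rw [mul_assoc]
  gcongr
  · exact (le_abs_self _).trans (hb t)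
  · exact ht.2

theorem isCutoff_radialAverage (hρ : IsProfile (1 / 2) ρ) {L : NNReal} (hL : LipschitzWith L f)
    (hfs : HasCompactSupport f) (hf0 : ∀ x, 0 ≤ f x) (hf1 : f 0 = 1)
    (hfg : ∀ k, 𝓕 (fun x => (f x : ℂ)) k = g k) (hg : ∀ k, 0 ≤ g k)
    (hrad : ∀ k l, ‖k‖ = ‖l‖ → g k = g l) :
    IsCutoff (radialAverage ρ f) (radialAverageFourier ρ g) where
  continuous := continuous_radialAverage hρ.integrable hL.continuous hfs
  hasCompactSupport := hasCompactSupport_radialAverage hρ hfs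
  nonneg x := integral_nonneg fun t => mul_nonneg (hρ.nonneg t) (hf0 _)
  apply_zero := by simp only [radialAverage, smul_zero, hf1, mul_one, hρ.integral_eq_one]
  fourier_eq := fourier_radialAverage hρ hL.continuous.measurable
    (hL.continuous.integrable_of_hasCompactSupport hfs) hfg
  fourier_nonneg := radialAverageFourier_nonneg hρ hg
  decay := by
    have hf := hL.continuous.integrable_of_hasCompactSupport (μ := volume) hfs
    obtain ⟨b, hb, hgb⟩ := exists_radialAverageFourier_le hρ (continuous_of_fourier_eq hf hfg) hg
    obtain ⟨C, hC⟩ := exists_norm_pow_mul_integral_ray_le hf hfg hL hg hrad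
    refine ⟨b * C, fun k => ?_⟩
    calc _ ≤ ‖k‖ ^ (finrank ℝ V + 1) * (b * ∫ t in (1 / 2 : ℝ)..(3 / 2), g (t • k)) := by
          gcongr
          exact hgb k
      _ = b * (‖k‖ ^ (finrank ℝ V + 1) * ∫ t in (1 / 2 : ℝ)..(3 / 2), g (t • k)) :=
          mul_left_comm _ _ _
      _ ≤ b * C := by gcongr; exact hC k

end RadialAverage

end

/-! ### The overlap of two balls -/

section BallOverlap

variable {d : ℕ}

lemma indB_of_le {r : ℝ} {x : E d} (h : ‖x‖ ≤ r) : indB d r x = 1 :=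
  indicator_of_mem (mem_closedBall_zero_iff.2 h) _

lemma indB_of_lt {r : ℝ} {x : E d} (h : r < ‖x‖) : indB d r x = 0 :=
  indicator_of_notMem (fun hx => h.not_ge (mem_closedBall_zero_iff.1 hx)) _

lemma indB_nonneg (r : ℝ) (x : E d) : 0 ≤ indB d r x :=
  indicator_nonneg (fun _ _ => zero_le_one) _

lemma indB_le_one (r : ℝ) (x : E d) : indB d r x ≤ 1 :=
  indicator_le_self' (fun _ _ => zero_le_one) _

lemma indB_congr {x y : E d} (h : ‖x‖ = ‖y‖) (r : ℝ) : indB d r x = indB d r y := by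
  simp only [indB, indicator, B, mem_closedBall_zero_iff, h, Pi.one_apply]

lemma indB_smul {t : ℝ} (ht : 0 < t) (x : E d) : indB d t x = indB d 1 (t⁻¹ • x) := by
  simp only [indB, indicator, B, mem_closedBall_zero_iff, norm_smul, norm_inv,
    Real.norm_of_nonneg ht.le, inv_mul_le_iff₀ ht, mul_one,
    Pi.one_apply]

lemma measurable_indB (r : ℝ) : Measurable (indB d r) :=
  measurable_one.indicator measurableSet_closedBall

lemma integrable_indB (r : ℝ) : Integrable (indB d r) :=
  (integrable_indicator_iff measurableSet_closedBall).2
    (integrableOn_const measure_closedBall_lt_top.ne)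

lemma integral_indB (r : ℝ) : ∫ x, indB d r x = volB d r :=
  integral_indicator_one measurableSet_closedBall

lemma abs_indB_sub_le (r : ℝ) (x y : E d) :
    |indB d r x - indB d r y| ≤ indB d (r + ‖x - y‖) x - indB d (r - ‖x - y‖) x := by
  have hxy := norm_nonneg (x - y)
  have hx : ‖x‖ ≤ ‖y‖ + ‖x - y‖ := norm_le_norm_add_norm_sub' x y
  have hy : ‖y‖ ≤ ‖x‖ + ‖x - y‖ := norm_le_norm_add_norm_sub x y
  rcases le_or_gt ‖x‖ (r - ‖x - y‖) with hin | hin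
  · rw [indB_of_le hin, indB_of_le (r := r + _) (by linarith), indB_of_le (x := x) (by linarith),
      indB_of_le (x := y) (by linarith), sub_self, abs_zero]
  rw [indB_of_lt hin, sub_zero]
  rcases le_or_gt ‖x‖ (r + ‖x - y‖) with hout | hout
  · rw [indB_of_le hout, abs_le]
    constructor <;> linarith [indB_nonneg r x, indB_nonneg r y, indB_le_one r x, indB_le_one r y]
  · rw [indB_of_lt hout, indB_of_lt (x := x) (by linarith), indB_of_lt (x := y) (by linarith),
      sub_self, abs_zero]

lemma volB_eq {t : ℝ} (ht : 0 ≤ t) : volB d t = t ^ d * volB d 1 := by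
  simpa only [volB, B, finrank_euclideanSpace_fin] using
    Measure.addHaar_real_closedBall' (volume : Measure (E d)) 0 ht

lemma volB_one_pos : 0 < volB d 1 :=
  ENNReal.toReal_pos (Metric.measure_closedBall_pos _ _ one_pos).ne' measure_closedBall_lt_top.ne

lemma one_lt_growth (hd : 1 ≤ d) : 1 < 1 + 4 * √(d : ℝ) * volB d 1 := by
  have := volB_one_pos (d := d)
  have : (0 : ℝ) < d := by exact_mod_cast hd
  exact lt_add_of_pos_right _ (by positivity)

lemma ballConv_apply (r : ℝ) (x : E d) :
    ballConv d r x = ∫ y, indB d r y * indB d r (x - y) := rfl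

lemma ballConv_eq {t : ℝ} (ht : 0 < t) (x : E d) :
    ballConv d t x = t ^ d * ballConv d 1 (t⁻¹ • x) := by
  have hscale := Measure.integral_comp_inv_smul_of_nonneg (volume : Measure (E d))
    (fun y => indB d 1 y * indB d 1 (t⁻¹ • x - y)) ht.le
  rw [finrank_euclideanSpace_fin, smul_eq_mul] at hscale
  rw [ballConv_apply, ballConv_apply, ← hscale]
  simp only [indB_smul ht, smul_sub]

lemma integrable_indB_mul (r : ℝ) (x : E d) :
    Integrable fun y => indB d r y * indB d r (x - y) := by
  have := measurable_indB (d := d) r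
  refine (integrable_indB r).mono' (Measurable.aestronglyMeasurable (by fun_prop))
    (Eventually.of_forall fun y => ?_)
  rw [Real.norm_of_nonneg (mul_nonneg (indB_nonneg _ _) (indB_nonneg _ _))]
  exact mul_le_of_le_one_right (indB_nonneg _ _) (indB_le_one _ _)

lemma ballConv_nonneg (r : ℝ) (x : E d) : 0 ≤ ballConv d r x :=
  integral_nonneg fun _ => mul_nonneg (indB_nonneg _ _) (indB_nonneg _ _)

lemma ballConv_le (r : ℝ) (x : E d) : ballConv d r x ≤ volB d r := by
  rw [ballConv_apply, ← integral_indB]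
  exact integral_mono (integrable_indB_mul r x) (integrable_indB r) fun y =>
    mul_le_of_le_one_right (indB_nonneg _ _) (indB_le_one _ _)

lemma ballConv_zero (r : ℝ) : ballConv d r 0 = volB d r := by
  rw [ballConv_apply, ← integral_indB]
  refine integral_congr_ae (Eventually.of_forall fun y => ?_)
  simp only [zero_sub, indB_congr (norm_neg y) r]
  rcases le_or_gt ‖y‖ r with h | h
  · rw [indB_of_le h, one_mul]
  · rw [indB_of_lt h, zero_mul]

lemma ballConv_neg (r : ℝ) (x : E d) : ballConv d r (-x) = ballConv d r x := by
  rw [ballConv_apply, ballConv_apply, ← integral_neg_eq_self]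
  congr 1 with y
  rw [indB_congr (norm_neg y), indB_congr (norm_sub_rev (-x) (-y)), neg_sub_neg]

lemma ballConv_eq_zero {r : ℝ} {x : E d} (hx : 2 * r < ‖x‖) : ballConv d r x = 0 := by
  refine integral_eq_zero_of_ae (Eventually.of_forall fun y => ?_)
  change indB d r y * indB d r (x - y) = 0
  rcases le_or_gt ‖y‖ r with h | h
  · have hxy : ‖x‖ ≤ ‖y‖ + ‖x - y‖ := norm_le_norm_add_norm_sub' x y
    rw [indB_of_lt (x := x - y) (by linarith), mul_zero]
  · rw [indB_of_lt h, zero_mul]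

lemma abs_ballConv_sub_le {r : ℝ} (x y : E d) :
    |ballConv d r x - ballConv d r y| ≤ volB d (r + ‖x - y‖) - volB d (r - ‖x - y‖) := by
  rw [ballConv_apply, ballConv_apply,
    ← integral_sub (integrable_indB_mul r x) (integrable_indB_mul r y), ← Real.norm_eq_abs,
    ← integral_indB, ← integral_indB, ← integral_sub (integrable_indB _) (integrable_indB _),
    ← integral_sub_left_eq_self
      (fun u => indB d (r + ‖x - y‖) u - indB d (r - ‖x - y‖) u) volume x]
  refine norm_integral_le_of_norm_le
    (((integrable_indB _).sub (integrable_indB _)).comp_sub_left x)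
    (Eventually.of_forall fun u => ?_)
  have hu := abs_indB_sub_le r (x - u) (y - u)
  rw [sub_sub_sub_cancel_right] at hu
  rw [← mul_sub, norm_mul, Real.norm_of_nonneg (indB_nonneg _ _), Real.norm_eq_abs]
  exact (mul_le_of_le_one_left (abs_nonneg _) (indB_le_one _ _)).trans hu

/-- The normalized overlap `|B_1 ∩ (x + B_1)| / |B_1|` of two unit balls. -/
def ballOverlap (d : ℕ) (x : E d) : ℝ := ballConv d 1 x / volB d 1

lemma ballConv_div_volB {t : ℝ} (ht : 0 < t) (x : E d) :
    ballConv d t x / volB d t = ballOverlap d (t⁻¹ • x) := by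
  rw [ballConv_eq ht, volB_eq ht.le, ballOverlap, mul_div_mul_left _ _ (by positivity)]

lemma ballOverlap_nonneg (x : E d) : 0 ≤ ballOverlap d x :=
  div_nonneg (ballConv_nonneg _ _) volB_one_pos.le

lemma ballOverlap_le_one (x : E d) : ballOverlap d x ≤ 1 :=
  (div_le_one volB_one_pos).2 (ballConv_le _ _)

lemma ballOverlap_zero : ballOverlap d 0 = 1 := by
  rw [ballOverlap, ballConv_zero, div_self volB_one_pos.ne']

lemma hasCompactSupport_ballOverlap : HasCompactSupport (ballOverlap d) := by
  refine HasCompactSupport.intro (isCompact_closedBall (0 : E d) 2) fun x hx => ?_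
  have hx2 : 2 * 1 < ‖x‖ := by
    rw [mul_one]
    exact not_le.1 fun h => hx (mem_closedBall_zero_iff.2 h)
  rw [ballOverlap, ballConv_eq_zero hx2, zero_div]

lemma one_add_pow_le {δ : ℝ} (h0 : 0 ≤ δ) (h1 : δ ≤ 1) (n : ℕ) :
    (1 + δ) ^ n ≤ 1 + δ * (2 ^ n - 1) := by
  have hconv := (convexOn_pow n).2 (x := 1) (y := 2) (by norm_num) (by norm_num)
    (sub_nonneg.2 h1) h0 (sub_add_cancel 1 δ)
  simp only [smul_eq_mul, one_pow] at hconv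
  calc (1 + δ) ^ n = ((1 - δ) * 1 + δ * 2) ^ n := by ring
    _ ≤ (1 - δ) * 1 + δ * 2 ^ n := hconv
    _ = 1 + δ * (2 ^ n - 1) := by ring

lemma abs_ballOverlap_sub_le (x y : E d) :
    |ballOverlap d x - ballOverlap d y| ≤ (d + 2 ^ d) * ‖x - y‖ := by
  have hv := volB_one_pos (d := d)
  have : (0 : ℝ) ≤ d := d.cast_nonneg
  have hxy := norm_nonneg (x - y)
  rcases le_or_gt ‖x - y‖ 1 with h | h
  · have hupper := one_add_pow_le hxy h d
    have hlower := one_add_mul_le_pow (a := -‖x - y‖) (by linarith) d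
    rw [← sub_eq_add_neg] at hlower
    rw [ballOverlap, ballOverlap, ← sub_div, abs_div, abs_of_pos hv, div_le_iff₀ hv]
    calc _ ≤ volB d (1 + ‖x - y‖) - volB d (1 - ‖x - y‖) := abs_ballConv_sub_le x y
      _ = ((1 + ‖x - y‖) ^ d - (1 - ‖x - y‖) ^ d) * volB d 1 := by
        rw [volB_eq (by linarith), volB_eq (t := 1 - ‖x - y‖) (by linarith), sub_mul]
      _ ≤ (d + 2 ^ d) * ‖x - y‖ * volB d 1 := by gcongr; linarith
  · have htwo : (1 : ℝ) ≤ 2 ^ d := one_le_pow₀ (by norm_num)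
    calc |ballOverlap d x - ballOverlap d y| ≤ 1 :=
        abs_sub_le_of_nonneg_of_le (ballOverlap_nonneg x) (ballOverlap_le_one x)
          (ballOverlap_nonneg y) (ballOverlap_le_one y)
      _ ≤ (d + 2 ^ d) * ‖x - y‖ := one_le_mul_of_one_le_of_one_le (by linarith) h.le

lemma lipschitzWith_ballOverlap : LipschitzWith (d + 2 ^ d) (ballOverlap d) :=
  LipschitzWith.of_dist_le_mul fun x y => by
    rw [Real.dist_eq, dist_eq_norm]
    exact_mod_cast abs_ballOverlap_sub_le x y

/-- The Fourier transform of `ballOverlap`. -/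
def overlapFourier (d : ℕ) (k : E d) : ℝ :=
  ‖𝓕⁻ (fun x => (indB d 1 x : ℂ)) k‖ ^ 2 / volB d 1

lemma overlapFourier_nonneg (k : E d) : 0 ≤ overlapFourier d k :=
  div_nonneg (sq_nonneg _) volB_one_pos.le

lemma overlapFourier_eq_of_norm_eq {k l : E d} (h : ‖k‖ = ‖l‖) :
    overlapFourier d k = overlapFourier d l := by
  set A := (Submodule.span ℝ {k - l})ᗮ.reflection
  have hA : (fun x => (indB d 1 x : ℂ)) ∘ A = fun x => (indB d 1 x : ℂ) := by
    ext x
    rw [Function.comp_apply, indB_congr (A.norm_map x)]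
  rw [overlapFourier, overlapFourier, ← Submodule.reflection_sub h,
    ← Real.fourierInv_comp_linearIsometry, hA]

lemma ofReal_ballConv (r : ℝ) (x : E d) :
    (ballConv d r x : ℂ) = autocorrelation (fun x => (indB d r x : ℂ)) x := by
  rw [ballConv_apply, ← integral_complex_ofReal, autocorrelation, convolution_def]
  simp only [ContinuousLinearMap.mul_apply', Complex.conj_ofReal, indB_congr (norm_neg _),
    Complex.ofReal_mul]

lemma fourier_ballOverlap (k : E d) :
    𝓕 (fun x => (ballOverlap d x : ℂ)) k = overlapFourier d k := by
  have hint : Integrable fun x : E d => (indB d 1 x : ℂ) := (integrable_indB 1).ofReal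
  have heven : (fun x : E d => (ballOverlap d (-x) : ℂ)) = fun x =>
      autocorrelation (fun x => (indB d 1 x : ℂ)) x * (volB d 1 : ℂ)⁻¹ := by
    ext x
    rw [ballOverlap, ballConv_neg, Complex.ofReal_div, ofReal_ballConv, div_eq_mul_inv]
  rw [← fourierInv_comp_neg, heven, Real.fourierInv_eq', overlapFourier, div_eq_mul_inv,
    Complex.ofReal_mul, ← fourierInv_autocorrelation hint, Real.fourierInv_eq',
    Complex.ofReal_inv, ← integral_mul_const]
  simp only [smul_eq_mul, mul_assoc]

lemma Q₀_eq_radialAverage {η : ℝ} {ρ : ℝ → ℝ} (hη : 0 < η) (hη' : η ≤ 1 / 2)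
    (hρ : IsProfile η ρ) : Q₀ d η ρ = radialAverage ρ (ballOverlap d) := by
  ext x
  rw [Q₀, intervalIntegral.integral_of_le (by linarith), ← integral_Icc_eq_integral_Ioc,
    setIntegral_eq_integral_of_forall_compl_eq_zero fun t ht => by
      rw [hρ.eq_zero_of_notMem ht, mul_zero]]
  refine integral_congr_ae (Eventually.of_forall fun t => ?_)
  by_cases ht : ρ t = 0
  · simp only [ht, mul_zero, zero_mul]
  · have ht0 : 0 < t := by linarith [(hρ.mono hη').half_le_of_ne_zero ht]
    simp only [ballConv_div_volB ht0, mul_comm]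

theorem isCutoff_Q₀ {η : ℝ} {ρ : ℝ → ℝ} (hη : 0 < η) (hη' : η ≤ 1 / 2) (hρ : IsProfile η ρ) :
    IsCutoff (Q₀ d η ρ) (radialAverageFourier ρ (overlapFourier d)) := by
  rw [Q₀_eq_radialAverage hη hη' hρ]
  exact isCutoff_radialAverage (hρ.mono hη') lipschitzWith_ballOverlap
    hasCompactSupport_ballOverlap ballOverlap_nonneg ballOverlap_zero fourier_ballOverlap
    overlapFourier_nonneg fun _ _ => overlapFourier_eq_of_norm_eq

end BallOverlap

/-! ### Positive definiteness for a general cutoff -/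

namespace IsCutoff

variable {d : ℕ} {Q m : E d → ℝ} {s : ℝ}

lemma isPositiveDefinite_average (hQ : IsCutoff Q m) (hs : 0 < s) (hsd : s < d) {ι : Type*}
    {t : Finset ι} {R : ι → ℝ} (hR : ∀ i ∈ t, 0 < R i) {c : ℝ} (hc : 0 ≤ c) :
    IsPositiveDefinite fun x => c * ∑ i ∈ t, rieszAverage (fun y => Q ((R i)⁻¹ • y)) s x := by
  have haverage := (HasRieszMultiplier.sum fun i hi =>
    hQ.hasRieszMultiplier_average_dilate hs (by simpa using hsd) (hR i hi)).const_mul c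
  refine haverage.isPositiveDefinite hs hsd (Eventually.of_forall fun k => ?_)
  exact mul_nonneg hc (Finset.sum_nonneg fun i _ =>
    div_nonneg (hQ.fourier_nonneg _) hQ.integral_pos.le)

lemma isPositiveDefinite_riesz_add_and_sub_mul (hQ : IsCutoff Q m) (hs : 0 < s) (hsd : s < d)
    {R C : ℝ} (hR : 0 < R) (hC : ∀ k, k ≠ 0 → rieszRatio m (finrank ℝ (E d) - s) k ≤ C) :
    IsPositiveDefinite (fun x => C / ‖x‖ ^ s + Q (R⁻¹ • x) / ‖x‖ ^ s) ∧
      IsPositiveDefinite (fun x => C / ‖x‖ ^ s - Q (R⁻¹ • x) / ‖x‖ ^ s) := by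
  have : Nonempty (Fin d) := ⟨⟨0, by exact_mod_cast hs.trans hsd⟩⟩
  have hne : ∀ᵐ k : E d, k ≠ 0 := by simp [ae_iff]
  simp only [div_eq_mul_inv C, ← Real.rpow_neg (norm_nonneg _)]
  refine (hQ.hasRieszMultiplier_mul_dilate hs (by simpa using hsd)
    hR).isPositiveDefinite_riesz_add_and_sub hs hsd (hne.mono fun k hk => ?_)
  rw [abs_of_nonneg (rieszRatio_nonneg hQ.fourier_nonneg _ _)]
  exact hC _ (smul_ne_zero hR.ne' hk)

lemma isPositiveDefinite_riesz_add_and_sub_error (hQ : IsCutoff Q m) (hs : 0 < s) (hsd : s < d)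
    {C C' e μ : ℝ} (hC : 0 ≤ C) (he : 0 < e)
    (hp : ∀ k, k ≠ 0 → |1 - rieszRatio m (finrank ℝ (E d) - s) k - m k / ∫ x, Q x|
      ≤ C * min (‖k‖ ^ e) (‖k‖ ^ e)⁻¹)
    (hμ : 1 < μ) (hC' : C * (2 * (μ ^ e / (μ ^ e - 1))) ≤ C') {M : ℕ} (hM : 1 ≤ M) {R : ℕ → ℝ}
    (h1 : 0 < R 1) (hR : ∀ k, 1 ≤ k → k < M → μ * R k ≤ R (k + 1)) :
    IsPositiveDefinite (fun x => C' / M * ‖x‖ ^ (-s)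
        + 1 / M * ∑ i ∈ Finset.Icc 1 M, rieszError (fun y => Q ((R i)⁻¹ • y)) s x) ∧
      IsPositiveDefinite (fun x => C' / M * ‖x‖ ^ (-s)
        - 1 / M * ∑ i ∈ Finset.Icc 1 M, rieszError (fun y => Q ((R i)⁻¹ • y)) s x) := by
  have : Nonempty (Fin d) := ⟨⟨0, by exact_mod_cast hs.trans hsd⟩⟩
  have hne : ∀ᵐ k : E d, k ≠ 0 := by simp [ae_iff]
  have herror := (HasRieszMultiplier.sum fun i hi => hQ.hasRieszMultiplier_error_dilate hs
    (by simpa using hsd) (pos_of_lacunary (by linarith) h1 hR hi)).const_mul (1 / (M : ℝ))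
  refine herror.isPositiveDefinite_riesz_add_and_sub hs hsd (hne.mono fun k hk => ?_)
  rw [abs_mul, abs_of_nonneg (by positivity), one_div_mul_eq_div]
  gcongr
  exact (abs_sum_dilate_le hC he hp hμ hM h1 hR hk).trans hC'

end IsCutoff

theorem propositionA5_general {d : ℕ} {ε μ : ℝ} {Q m : E d → ℝ} (hQ : IsCutoff Q m)
    (hε : 0 < ε) (hμ : 1 < μ) :
    ∃ C : ℝ, 0 < C ∧ ∀ s : ℝ, ε ≤ s → s ≤ (d : ℝ) - ε → ∀ M : ℕ, 1 ≤ M → ∀ R : ℕ → ℝ,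
      0 < R 1 → (∀ k, 1 ≤ k → k < M → μ * R k ≤ R (k + 1)) →
        IsPositiveDefinite (fun x : E d => C / M * ‖x‖ ^ (-s)
          + 1 / M * ∑ i ∈ Finset.Icc 1 M, rieszError (fun y => Q ((R i)⁻¹ • y)) s x) ∧
        IsPositiveDefinite (fun x : E d => C / M * ‖x‖ ^ (-s)
          - 1 / M * ∑ i ∈ Finset.Icc 1 M, rieszError (fun y => Q ((R i)⁻¹ • y)) s x) ∧
        IsPositiveDefinite (fun x : E d =>
          1 / M * ∑ i ∈ Finset.Icc 1 M, rieszAverage (fun y => Q ((R i)⁻¹ • y)) s x) ∧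
        ∀ i : ℕ, 1 ≤ i → i ≤ M →
          IsPositiveDefinite (fun x : E d => C / ‖x‖ ^ s + Q ((R i)⁻¹ • x) / ‖x‖ ^ s) ∧
          IsPositiveDefinite (fun x : E d => C / ‖x‖ ^ s - Q ((R i)⁻¹ • x) / ‖x‖ ^ s) := by
  by_cases hεd : ε ≤ d - ε
  swap
  · exact ⟨1, one_pos, fun s hs hs' => absurd (hs.trans hs') hεd⟩
  set e := min ε (1 / 2)
  have he : 0 < e := lt_min hε (by norm_num)
  have hμe : 0 < μ ^ e - 1 := sub_pos.2 (Real.one_lt_rpow hμ he)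
  obtain ⟨C, hC, hbound⟩ := hQ.exists_multiplier_bounds (b := d - ε) (e := e) (by linarith)
    (by simpa using hε) he.le ((min_le_right _ _).trans_lt (by norm_num))
  set K := 2 * (μ ^ e / (μ ^ e - 1))
  have hK : 0 ≤ K := by positivity
  refine ⟨C * (1 + K), by positivity, fun s hs hs' M hM R h1 hR => ?_⟩
  have hs0 : 0 < s := hε.trans_le hs
  have hsd : s < d := by linarith
  have hpos : ∀ i ∈ Finset.Icc 1 M, 0 < R i := fun i => pos_of_lacunary (by linarith) h1 hR
  replace hbound := hbound (finrank ℝ (E d) - s)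
    ((min_le_left _ _).trans (by simp only [finrank_euclideanSpace_fin]; linarith))
    (by simp only [finrank_euclideanSpace_fin]; linarith)
  obtain ⟨hadd, hsub⟩ := hQ.isPositiveDefinite_riesz_add_and_sub_error hs0 hsd hC.le he
    (fun k hk => (hbound k hk).2) hμ (C' := C * (1 + K)) (by gcongr; linarith) hM h1 hR
  exact ⟨hadd, hsub, hQ.isPositiveDefinite_average hs0 hsd hpos (by positivity), fun i hi hiM =>
    hQ.isPositiveDefinite_riesz_add_and_sub_mul hs0 hsd (hpos i (Finset.mem_Icc.2 ⟨hi, hiM⟩))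
      fun k hk => (hbound k hk).1.trans (by nlinarith)⟩

end FeffermanGregg

end

theorem propositionA5 (d : ℕ) (ε : ℝ) (hε : 0 < ε) (hεd : ε < (d : ℝ) / 2)
    (η : ℝ) (hη : 0 < η) (hη' : η ≤ 1 / 2)
    (ρ : ℝ → ℝ) (hρ : FeffermanGregg.IsProfile η ρ) :
    ∃ C : ℝ, 0 < C ∧
      ∀ s : ℝ, ε ≤ s → s ≤ (d : ℝ) - ε →
      ∀ M : ℕ, 1 ≤ M → ∀ R : ℕ → ℝ, FeffermanGregg.IsScales d M R →
        FeffermanGregg.IsPositiveDefinite (fun x : FeffermanGregg.E d =>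
          C / M * ‖x‖ ^ (-s)
            + 1 / M * ∑ i ∈ Finset.Icc 1 M, FeffermanGregg.errRiesz d η ρ s (R i) x) ∧
        FeffermanGregg.IsPositiveDefinite (fun x : FeffermanGregg.E d =>
          C / M * ‖x‖ ^ (-s)
            - 1 / M * ∑ i ∈ Finset.Icc 1 M, FeffermanGregg.errRiesz d η ρ s (R i) x) ∧
        FeffermanGregg.IsPositiveDefinite (fun x : FeffermanGregg.E d =>
          1 / M * ∑ i ∈ Finset.Icc 1 M, FeffermanGregg.avgRiesz d η ρ s (R i) x) ∧
        ∀ i : ℕ, 1 ≤ i → i ≤ M →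
          FeffermanGregg.IsPositiveDefinite (fun x : FeffermanGregg.E d =>
            C / ‖x‖ ^ s + FeffermanGregg.Q d η ρ (R i) x / ‖x‖ ^ s) ∧
          FeffermanGregg.IsPositiveDefinite (fun x : FeffermanGregg.E d =>
            C / ‖x‖ ^ s - FeffermanGregg.Q d η ρ (R i) x / ‖x‖ ^ s) := by
  have hd : 1 ≤ d := Nat.cast_pos.1 (by linarith : (0 : ℝ) < d)
  obtain ⟨C, hC, h⟩ := FeffermanGregg.propositionA5_general
    (FeffermanGregg.isCutoff_Q₀ hη hη' hρ) hε (FeffermanGregg.one_lt_growth hd)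
  exact ⟨C, hC, fun s hs hs' M hM R hR =>
    h s hs hs' M hM R hR.pos fun k hk hkM => (hR.growth k hk hkM).le⟩
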